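/- Let $p$ be a prime and let $X=\{0,1,\dots,p-1\}$. Let $\mathrm{Aut}(X^*)$ be the group of automorphisms of the $p$-ary rooted tree $X^*$ of finite words over $X$, acting on the left. For $g\in\mathrm{Aut}(X^*)$ and $x\in X$, the section $g_x\in\mathrm{Aut}(X^*)$ is defined by $g(xw)=g(x)\,g_x(w)$ for all words $w$. Write $g=\pi_g(g_0,\dots,g_{p-1})$, where $\pi_g$ is the permutation of $X$ induced by $g$. For $H\le\mathrm{Aut}(X^*)$ let $H_1$ be the stabilizer of the first level in $H$, and let $\psi(g)=(g_0,\dots,g_{p-1})$ for $g\in H_1$. A subgroup $G\le\mathrm{Aut}(X^*)$ is a *regular branch group over* a subgroup $K\le G$ if $G$ acts transitively on every level of $X^*$, $K$ is normal of finite index in $G$, and $K\times\dots\times K$ ($p$ factors) is contained in $\psi(K_1)$. Let $f=x^m+a_{m-1}x^{m-1}+\dots+a_0$ be a monic polynomial of degree $m$ over the field $\mathbb{F}_p$ with $a_0\neq 0$. Let $B=\mathbb{F}_p^m$ with standard basis $d_0,\dots,d_{m-1}$. Let $\rho:B\to B$ be the linear map with $\rho(d_i)=d_{i+1}$ for $0\le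 i\le m-2$ and $\rho(d_{m-1})=-\sum_{i=0}^{m-1}a_id_i$, and let $\omega:B\to\mathbb{F}_p$ be the last-coordinate functional. Let $a=\pi(1,\dots,1)$ with $\pi=(0\;1\;\dots\;p-1)$, and let each $b\in B$ act on $X^*$ by the automorphism defined recursively by $b=(a^{\omega(b)},1,\dots,1,\rho(b))$. The group $G_{p,f}\le\mathrm{Aut}(X^*)$ is generated by $a$ and the automorphisms defined by the elements of $B$. Let $\mathcal G_{p,m}$ be the family of all groups $G_{p,f}$ with $f$ of this form, and put $B_1=\rho(\ker\omega)$. **Theorem.** Let $m\ge 2$ and let $G=G_{p,f}\in\mathcal G_{p,m}$. (a) If $p\ne 2$, then $G$ is a regular branch group over its commutator subgroup $G'$. Moreover $[G:G']=p^{m+1}$, and $\psi^{-1}(G'\times\dots\times G')$ is contained in $G'$ with $[G':\psi^{-1}(G'\times\dots\times G')]=p^{m(p-1)}$. (b) If $p=2$, then $G$ is a regular branch group over the normal closure $K=\langle [a,b] : b\in B_1\rangle^G$ in $G$ of the commutators $[a,b]=a^{-1}b^{-1}ab$ with $b\in B_1$. Moreover $[G:K]=2^{m+2}$, and $\psi^{-1}(K\times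 K)$ is contained in $K$ with $[K:\psi^{-1}(K\times K)]=2^{m}$. Here $\psi^{-1}$ denotes the preimage under $\psi:G_1\to\mathrm{Aut}(X^*)^p$. -/

import Mathlib

/-- The group `Aut(X^*)` of automorphisms of the rooted tree `X^*` of finite words over `X`:
the permutations of the set of words that preserve the levels and the prefix relation. -/
def TreeAut (X : Type*) : Subgroup (Equiv.Perm (List X)) where
  carrier := {g | (∀ u, (g u).length = u.length) ∧ ∀ u v, g u <+: g v ↔ u <+: v}
  mul_mem' := by
    rintro g h ⟨hg, hg'⟩ ⟨hh, hh'⟩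
    exact ⟨fun u => by simp [hg, hh], fun u v => by simp [hg', hh']⟩
  one_mem' := by simp
  inv_mem' := by
    rintro g ⟨hg, hg'⟩
    refine ⟨fun u => ?_, fun u v => ?_⟩
    · have := hg (g⁻¹ u)
      simpa using this.symm
    · have := hg' (g⁻¹ u) (g⁻¹ v)
      simpa using this.symm

namespace TreeAut

variable {X : Type*}

theorem length_apply (g : TreeAut X) (u : List X) : (g.1 u).length = u.length := g.2.1 u

theorem inv_apply_self (g : TreeAut X) (u : List X) : (g⁻¹).1 (g.1 u) = u := by
  rw [Subgroup.coe_inv]; exact Equiv.symm_apply_apply g.1 u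

theorem apply_inv_self (g : TreeAut X) (u : List X) : g.1 ((g⁻¹).1 u) = u := by
  rw [Subgroup.coe_inv]; exact Equiv.apply_symm_apply g.1 u

/-- `g (u w) = g u · (tail)`, the tail being what remains of `g (u w)` after `|u|` letters. -/
theorem apply_append (g : TreeAut X) (u w : List X) :
    g.1 (u ++ w) = g.1 u ++ (g.1 (u ++ w)).drop u.length := by
  obtain ⟨t, ht⟩ := (g.2.2 u (u ++ w)).2 (List.prefix_append u w)
  rw [← ht, ← length_apply g u, List.drop_left]

/-- The underlying map on words of the section `g_u`. -/
def secFun (g : TreeAut X) (u w : List X) : List X := (g.1 (u ++ w)).drop u.length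

theorem apply_append' (g : TreeAut X) (u w : List X) :
    g.1 (u ++ w) = g.1 u ++ secFun g u w := apply_append g u w

theorem secFun_inv (g : TreeAut X) (u w : List X) :
    secFun g⁻¹ (g.1 u) (secFun g u w) = w := by
  have h := apply_append' g⁻¹ (g.1 u) (secFun g u w)
  rw [← apply_append', inv_apply_self, inv_apply_self] at h
  exact (List.append_cancel_left h).symm

/-- The section `g_u` of a tree automorphism `g` at a word `u`: the tree automorphism with
`g (u w) = g(u) g_u(w)` for all words `w`. -/
def sec (g : TreeAut X) (u : List X) : TreeAut X :=
  ⟨{ toFun := secFun g u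
     invFun := secFun g⁻¹ (g.1 u)
     left_inv := secFun_inv g u
     right_inv := fun w => by
       have h := secFun_inv g⁻¹ (g.1 u) w
       rwa [inv_inv, inv_apply_self] at h },
   by
     refine ⟨fun w => ?_, fun w w' => ?_⟩
     · simp [secFun, length_apply]
     · have h := g.2.2 (u ++ w) (u ++ w')
       rw [apply_append', apply_append', List.prefix_append_right_inj,
         List.prefix_append_right_inj] at h
       exact h⟩

theorem apply_append_sec (g : TreeAut X) (u w : List X) :
    g.1 (u ++ w) = g.1 u ++ (sec g u).1 w := apply_append' g u w

theorem sec_mul (g h : TreeAut X) (u : List X) :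
    sec (g * h) u = sec g (h.1 u) * sec h u := by
  apply Subtype.ext
  ext1 w
  have e := apply_append_sec (g * h) u w
  rw [Subgroup.coe_mul, Equiv.Perm.mul_apply, Equiv.Perm.mul_apply, apply_append_sec h,
    apply_append_sec g] at e
  exact (List.append_cancel_left e).symm

variable (X) in
/-- The stabilizer of level `n`, i.e. the tree automorphisms fixing every word of length `n`. -/
def levelStab (n : ℕ) : Subgroup (TreeAut X) where
  carrier := {g | ∀ u : List X, u.length = n → g.1 u = u}
  mul_mem' := by
    intro g h hg hh u hu
    rw [Subgroup.coe_mul, Equiv.Perm.mul_apply, hh u hu, hg u hu]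
  one_mem' := fun u _ => rfl
  inv_mem' := by
    intro g hg u hu
    have := inv_apply_self g u
    rwa [hg u hu] at this

variable (X) in
/-- The homomorphism `ψ` sending an element of the first level stabilizer to the tuple of its
sections at the letters. -/
def psi : levelStab X 1 →* (X → TreeAut X) where
  toFun g := fun x => sec g.1 [x]
  map_one' := by
    funext x
    apply Subtype.ext
    ext1 w
    rfl
  map_mul' := by
    intro g h
    funext x
    have e := sec_mul g.1 h.1 [x]
    rwa [h.2 [x] rfl] at e

/-- The direct product `K × ⋯ × K`, one factor for each letter. -/
def power (K : Subgroup (TreeAut X)) : Subgroup (X → TreeAut X) :=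
  Subgroup.pi Set.univ fun _ => K

/-- The subgroup `ψ⁻¹(K × ⋯ × K)` of `G`, for `ψ` restricted to the first level stabilizer
`G₁` of `G`. -/
def psiPreimage (G K : Subgroup (TreeAut X)) : Subgroup (TreeAut X) :=
  G ⊓ ((power K).comap (psi X)).map (levelStab X 1).subtype

/-- `H` geometrically contains `K × ⋯ × K`: `K × ⋯ × K ≤ ψ(H₁)`, where `H₁` is the first level
stabilizer of `H`. -/
def GeometricallyContainsPower (H K : Subgroup (TreeAut X)) : Prop :=
  power K ≤ (H.subgroupOf (levelStab X 1)).map (psi X)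

/-- `G` acts transitively on every level of the tree. -/
def SphericallyTransitive (G : Subgroup (TreeAut X)) : Prop :=
  ∀ u v : List X, u.length = v.length → ∃ g ∈ G, g.1 u = v

/-- `G` is a regular branch group, branching over its subgroup `K`. -/
structure IsRegularBranchOver (G K : Subgroup (TreeAut X)) : Prop where
  spherically_transitive : SphericallyTransitive G
  le : K ≤ G
  normal : (K.subgroupOf G).Normal
  finite_index : (K.subgroupOf G).FiniteIndex
  geometrically_contains : GeometricallyContainsPower K K

end TreeAut

namespace SpinalGroup

/-! The alphabet `{0, 1, …, p - 1}` is `ZMod p`; its last letter `p - 1` is `-1`, and the standard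
cycle `(0 1 … p-1)` is `x ↦ x + 1`. The groups `A` and `B` are written additively, as
`ZMod p` and an additive group (vector space) `B`. -/

variable {p : ℕ}

/-- Adding `k` to the first letter of a word. -/
def rootFun (k : ZMod p) : List (ZMod p) → List (ZMod p)
  | [] => []
  | x :: w => (x + k) :: w

theorem rootFun_zero (w : List (ZMod p)) : rootFun 0 w = w := by
  cases w <;> simp [rootFun]

theorem rootFun_add (k l : ZMod p) (w : List (ZMod p)) :
    rootFun k (rootFun l w) = rootFun (k + l) w := by
  cases w <;> simp [rootFun, add_comm, add_left_comm]

theorem rootFun_length (k : ZMod p) (w : List (ZMod p)) :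
    (rootFun k w).length = w.length := by
  cases w <;> simp [rootFun]

theorem rootFun_prefix (k : ZMod p) (u v : List (ZMod p)) :
    rootFun k u <+: rootFun k v ↔ u <+: v := by
  cases u <;> cases v <;> simp [rootFun, List.cons_prefix_cons]

/-- The element `a^k` of `A`, where `a = π (1, …, 1)`: it applies `π^k` to the first letter of a
word and changes nothing else. -/
def rootAut (k : ZMod p) : TreeAut (ZMod p) :=
  ⟨{ toFun := rootFun k
     invFun := rootFun (-k)
     left_inv := fun w => by rw [rootFun_add, neg_add_cancel, rootFun_zero]
     right_inv := fun w => by rw [rootFun_add, add_neg_cancel, rootFun_zero] },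
   rootFun_length k, rootFun_prefix k⟩

/-- The generator `a = π (1, …, 1)`. -/
def a (p : ℕ) : TreeAut (ZMod p) := rootAut 1

theorem rootAut_natCast (n : ℕ) : rootAut (n : ZMod p) = a p ^ n := by
  induction n with
  | zero =>
    apply Subtype.ext
    ext1 w
    rw [Nat.cast_zero]
    exact rootFun_zero w
  | succ n ih =>
    rw [pow_succ, ← ih]
    apply Subtype.ext
    ext1 w
    rw [Nat.cast_succ]
    exact (rootFun_add _ _ w).symm

variable {B : Type*} [AddCommGroup B]

/-- The action of `b ∈ B` on words, defined recursively by
`b = (ω(b), 1, …, 1, ρ(b))`. -/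
def spineFun (ω : B →+ ZMod p) (ρ : B →+ B) : B → List (ZMod p) → List (ZMod p)
  | _, [] => []
  | b, x :: w =>
    x :: (if x = 0 then rootFun (ω b) w else if x = -1 then spineFun ω ρ (ρ b) w else w)

theorem spineFun_zero (ω : B →+ ZMod p) (ρ : B →+ B) (w : List (ZMod p)) :
    spineFun ω ρ 0 w = w := by
  induction w with
  | nil => rfl
  | cons x w ih => simp [spineFun, ih, rootFun_zero]

theorem spineFun_add (ω : B →+ ZMod p) (ρ : B →+ B) (b c : B) (w : List (ZMod p)) :
    spineFun ω ρ b (spineFun ω ρ c w) = spineFun ω ρ (b + c) w := by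
  induction w generalizing b c with
  | nil => rfl
  | cons x w ih =>
    simp only [spineFun]
    split_ifs <;> simp [rootFun_add, ih]

theorem spineFun_length (ω : B →+ ZMod p) (ρ : B →+ B) (b : B) (w : List (ZMod p)) :
    (spineFun ω ρ b w).length = w.length := by
  induction w generalizing b with
  | nil => rfl
  | cons x w ih =>
    simp only [spineFun]
    split_ifs <;> simp [rootFun_length, ih]

theorem spineFun_prefix (ω : B →+ ZMod p) (ρ : B →+ B) (b : B) (u v : List (ZMod p)) :
    spineFun ω ρ b u <+: spineFun ω ρ b v ↔ u <+: v := by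
  induction u generalizing b v with
  | nil => simp [spineFun]
  | cons x u ih =>
    cases v with
    | nil => simp [spineFun]
    | cons y v =>
      simp only [spineFun, List.cons_prefix_cons]
      refine and_congr_right ?_
      rintro rfl
      split_ifs <;> simp [rootFun_prefix, ih]

/-- The tree automorphism defined by `b ∈ B`, namely `b = (ω(b), 1, …, 1, ρ(b))`. -/
def spineAut (ω : B →+ ZMod p) (ρ : B →+ B) (b : B) : TreeAut (ZMod p) :=
  ⟨{ toFun := spineFun ω ρ b
     invFun := spineFun ω ρ (-b)
     left_inv := fun w => by rw [spineFun_add, neg_add_cancel, spineFun_zero]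
     right_inv := fun w => by rw [spineFun_add, add_neg_cancel, spineFun_zero] },
   spineFun_length ω ρ b, spineFun_prefix ω ρ b⟩

/-- The group `G_{ω,ρ} = ⟨A ∪ B⟩` of tree automorphisms. -/
def groupOf (ω : B →+ ZMod p) (ρ : B →+ B) : Subgroup (TreeAut (ZMod p)) :=
  Subgroup.closure (Set.range (rootAut (p := p)) ∪ Set.range (spineAut ω ρ))

/-- The normal closure in `G_{ω,ρ}` of the commutators `[a, b] = a⁻¹ b⁻¹ a b` with
`b ∈ B₁ = ρ(Ker ω)`. -/
def branchK (ω : B →+ ZMod p) (ρ : B →+ B) : Subgroup (TreeAut (ZMod p)) :=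
  (Subgroup.normalClosure {g : groupOf ω ρ | ∃ b ∈ ω.ker.map ρ,
    (g : TreeAut (ZMod p)) = (a p)⁻¹ * (spineAut ω ρ b)⁻¹ * a p * spineAut ω ρ b}).map
    (groupOf ω ρ).subtype

/-- The companion matrix of `f = x^m + a_{m-1} x^{m-1} + ⋯ + a₀`: ones below the diagonal and
last column `(-a₀, …, -a_{m-1})`. -/
def rhoMatrix (f : Polynomial (ZMod p)) : Matrix (Fin f.natDegree) (Fin f.natDegree) (ZMod p) :=
  Matrix.of fun i j =>
    if (j : ℕ) + 1 = f.natDegree then -f.coeff i else if (i : ℕ) = j + 1 then 1 else 0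

/-- The row matrix `[0 0 … 0 1]`. -/
def omegaMatrix (f : Polynomial (ZMod p)) : Matrix (Fin 1) (Fin f.natDegree) (ZMod p) :=
  Matrix.of fun _ j => if (j : ℕ) + 1 = f.natDegree then 1 else 0

/-- The endomorphism `ρ` of `B = (ℤ/pℤ)^m` with matrix `rhoMatrix f`. -/
def rho (f : Polynomial (ZMod p)) : (Fin f.natDegree → ZMod p) →+ (Fin f.natDegree → ZMod p) :=
  (rhoMatrix f).mulVecLin.toAddMonoidHom

/-- The functional `ω` on `B = (ℤ/pℤ)^m` with matrix `omegaMatrix f`. -/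
def omega (f : Polynomial (ZMod p)) : (Fin f.natDegree → ZMod p) →+ ZMod p :=
  (LinearMap.proj (0 : Fin 1) ∘ₗ (omegaMatrix f).mulVecLin).toAddMonoidHom

/-- The group `G_{p,f}`. -/
def Gpf (f : Polynomial (ZMod p)) : Subgroup (TreeAut (ZMod p)) := groupOf (omega f) (rho f)

/-- The subgroup `K = ⟨[a, b] ∣ b ∈ B₁⟩^G` of `G = G_{p,f}`. -/
def Kpf (f : Polynomial (ZMod p)) : Subgroup (TreeAut (ZMod p)) := branchK (omega f) (rho f)

end SpinalGroup

/-!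
The group `G` is controlled through additive invariants. Every element of `G` acts on the first
letter by a translation, its `label`, and the sum of the labels of the sections at level `n` is a
homomorphism `G → 𝔽_p` for each `n`. On `b ∈ B` these homomorphisms take the values `ω(ρⁿ b)`, and
they separate the points of `B` because `ω` is a cyclic vector for the transpose of the companion
matrix. So they assemble to a homomorphism `spineDegree : G → B` that is the identity on `B`, and
`(spineDegree, label)` identifies `G / G'` with `B × A`, of order `p ^ (m + 1)`. Applied to the
sections, `spineDegree` maps the first level stabilizer `G₁` onto `B × ⋯ × B`, and its kernel there
is `ψ⁻¹(G' × ⋯ × G')`, as the `A`-part of the section at `x` is determined by the `B`-part of the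
section at `x - 1` (`exists_spineDegree_sec`). All indices for odd `p` follow from
`[G₁ : ψ⁻¹(G' × ⋯ × G')] = p ^ (m p)` and `[G₁ : G'] = p ^ m`.

Branching comes from commutators of conjugates `a^i b a^{-i}` of elements of `B` with a single
nontrivial section. As `G` is self-replicating, the elements `k` such that `(1, …, k, …, 1)` lies in
`ψ(K₁)` form a subgroup normalized by `G` (`liftable`), so it is enough that it contains the
generators `[a, b]` of `K`. For odd `p` the conjugates by `1` and `a` overlap in one letter only, so
all `[a, b]` occur. For `p = 2` one of the two elements must be in `ker ω`, and this gives `[a, b]`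
with `b ∈ B₁`.

For `p = 2` the group `K` has index `2` in `G'`. The upper bound is a normal form modulo `K`: with
`d ∈ ker ω` outside `B₁`, every element of `G` is `b a^k [a, d]ⁿ` modulo `K`, and `[a, d]` is an
involution. The lower bound is given by a character `G → 𝔽₂` evaluated on a section, `secCharacter`,
chosen to vanish on `[a, b]` exactly when `b ∈ B₁`. An element of `G₁` with both sections in `G'`
has its two sections in the same coset of `K` (`secCharacter_sec_eq`), so `ψ⁻¹(K × K)` has index `2`
in `ψ⁻¹(G' × G')`, and the remaining indices follow by multiplicativity.
-/

/-! ### Sections of tree automorphisms -/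

namespace TreeAut

variable {X : Type*}

theorem mem_levelStab_one {g : TreeAut X} :
    g ∈ levelStab X 1 ↔ ∀ x : X, g.1 [x] = [x] := by
  refine ⟨fun h x => h [x] rfl, fun h u hu => ?_⟩
  obtain ⟨x, rfl⟩ := List.length_eq_one_iff.1 hu
  exact h x

theorem ext_of_sec {g h : TreeAut X} (hr : ∀ x : X, g.1 [x] = h.1 [x])
    (hs : ∀ x : X, sec g [x] = sec h [x]) : g = h := by
  apply Subtype.ext
  ext1 w
  cases w with
  | nil =>
    rw [List.eq_nil_of_length_eq_zero (length_apply g []),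
      List.eq_nil_of_length_eq_zero (length_apply h [])]
  | cons x w =>
    have hg := apply_append_sec g [x] w
    have hh := apply_append_sec h [x] w
    rw [hr x, hs x, ← hh] at hg
    exact hg

theorem sec_one (u : List X) : sec (1 : TreeAut X) u = 1 := by
  have h := sec_mul (1 : TreeAut X) 1 u
  rw [one_mul] at h
  exact left_eq_mul.1 h

theorem sec_inv (g : TreeAut X) (u : List X) : sec g⁻¹ (g.1 u) = (sec g u)⁻¹ := by
  have h := sec_mul g⁻¹ g u
  rw [inv_mul_cancel, sec_one] at h
  exact eq_inv_of_mul_eq_one_left h.symm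

theorem sec_conj (g : TreeAut X) {h : TreeAut X} {u : List X} (hu : h.1 u = u) :
    sec (g * h * g⁻¹) (g.1 u) = sec g u * sec h u * (sec g u)⁻¹ := by
  rw [sec_mul, sec_mul, sec_inv, inv_apply_self, hu]

theorem sec_mul_of_mem {g h : TreeAut X} (hh : h ∈ levelStab X 1) (x : X) :
    sec (g * h) [x] = sec g [x] * sec h [x] := by
  rw [sec_mul, mem_levelStab_one.1 hh]

theorem sec_inv_of_mem {h : TreeAut X} (hh : h ∈ levelStab X 1) (x : X) :
    sec h⁻¹ [x] = (sec h [x])⁻¹ := by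
  conv_lhs => rw [← mem_levelStab_one.1 hh x]
  exact sec_inv h [x]

theorem ext_of_mem {g h : TreeAut X} (hg : g ∈ levelStab X 1) (hh : h ∈ levelStab X 1)
    (hs : ∀ x : X, sec g [x] = sec h [x]) : g = h :=
  ext_of_sec (fun x => by rw [mem_levelStab_one.1 hg, mem_levelStab_one.1 hh]) hs

theorem mem_psiPreimage {G K : Subgroup (TreeAut X)} {g : TreeAut X} :
    g ∈ psiPreimage G K ↔ g ∈ G ∧ g ∈ levelStab X 1 ∧ ∀ x : X, sec g [x] ∈ K := by
  simp only [psiPreimage, Subgroup.mem_inf, Subgroup.mem_map, Subgroup.mem_comap, power,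
    Subgroup.mem_pi, Set.mem_univ, true_imp_iff]
  constructor
  · rintro ⟨hG, ⟨g, hg⟩, hK, rfl⟩
    exact ⟨hG, hg, hK⟩
  · rintro ⟨hG, hg, hK⟩
    exact ⟨hG, ⟨g, hg⟩, hK, rfl⟩

theorem geometricallyContainsPower_iff {H K : Subgroup (TreeAut X)} :
    GeometricallyContainsPower H K ↔ ∀ s : X → TreeAut X, (∀ x, s x ∈ K) →
      ∃ h ∈ H, h ∈ levelStab X 1 ∧ ∀ x, sec h [x] = s x := by
  simp only [GeometricallyContainsPower, SetLike.le_def, power, Subgroup.mem_pi, Set.mem_univ,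
    true_imp_iff, Subgroup.mem_map, Subgroup.mem_subgroupOf]
  refine forall_congr' fun s => imp_congr_right fun _ => ⟨?_, ?_⟩
  · rintro ⟨h, hH, rfl⟩
    exact ⟨h.1, hH, h.2, fun x => rfl⟩
  · rintro ⟨h, hH, hs, e⟩
    exact ⟨⟨h, hs⟩, hH, funext e⟩

/-- If `K × ⋯ × K` is contained in `ψ(K₁)`, then `ψ⁻¹(K × ⋯ × K)` lies in `K`, because `ψ` is
injective. -/
theorem psiPreimage_le {G K : Subgroup (TreeAut X)} (h : GeometricallyContainsPower K K) :
    psiPreimage G K ≤ K := by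
  intro g hg
  obtain ⟨-, hs, hK⟩ := mem_psiPreimage.1 hg
  obtain ⟨k, hk, hks, e⟩ := geometricallyContainsPower_iff.1 h (fun x => sec g [x]) hK
  rwa [ext_of_mem hs hks fun x => (e x).symm]

theorem psiPreimage_mono {G H K : Subgroup (TreeAut X)} (hle : H ≤ K) :
    psiPreimage G H ≤ psiPreimage G K := fun _ hg => by
  rw [mem_psiPreimage] at hg ⊢
  exact ⟨hg.1, hg.2.1, fun x => hle (hg.2.2 x)⟩

theorem geometricallyContainsPower_of_mulSingle [Finite X] [DecidableEq X]
    {H K : Subgroup (TreeAut X)}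
    (h : ∀ x, ∀ k ∈ K, ∃ g ∈ H, g ∈ levelStab X 1 ∧
      ∀ y, sec g [y] = (Pi.mulSingle x k : X → TreeAut X) y) :
    GeometricallyContainsPower H K := by
  cases nonempty_fintype X
  intro s hs
  refine Subgroup.pi_mem_of_mulSingle_mem s fun x => ?_
  obtain ⟨g, hg, hgs, e⟩ := h x (s x) (hs x trivial)
  exact ⟨⟨g, hgs⟩, hg, funext e⟩

end TreeAut

/-! ### Generators of `G` and their sections -/

namespace SpinalGroup

open TreeAut

variable {p : ℕ}

theorem rootAut_add (k l : ZMod p) : rootAut (k + l) = rootAut k * rootAut l := by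
  apply Subtype.ext
  ext1 w
  exact (rootFun_add k l w).symm

theorem rootAut_zero : rootAut (0 : ZMod p) = 1 := by
  apply Subtype.ext
  ext1 w
  exact rootFun_zero w

theorem rootAut_neg (k : ZMod p) : rootAut (-k) = (rootAut k)⁻¹ :=
  eq_inv_of_mul_eq_one_left (by rw [← rootAut_add, neg_add_cancel, rootAut_zero])

theorem rootAut_apply (k x : ZMod p) : (rootAut k).1 [x] = [x + k] := rfl

theorem sec_rootAut (k x : ZMod p) : sec (rootAut k) [x] = 1 := by
  apply Subtype.ext
  ext1 w
  rfl

variable {B : Type*} [AddCommGroup B] (ω : B →+ ZMod p) (ρ : B →+ B)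

theorem spineAut_add (b c : B) : spineAut ω ρ (b + c) = spineAut ω ρ b * spineAut ω ρ c := by
  apply Subtype.ext
  ext1 w
  exact (spineFun_add ω ρ b c w).symm

theorem spineAut_zero : spineAut ω ρ 0 = 1 := by
  apply Subtype.ext
  ext1 w
  exact spineFun_zero ω ρ w

theorem spineAut_neg (b : B) : spineAut ω ρ (-b) = (spineAut ω ρ b)⁻¹ :=
  eq_inv_of_mul_eq_one_left (by rw [← spineAut_add, neg_add_cancel, spineAut_zero])

theorem spineAut_mem_levelStab (b : B) : spineAut ω ρ b ∈ levelStab (ZMod p) 1 := by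
  refine mem_levelStab_one.2 fun x => ?_
  change x :: _ = _
  split_ifs <;> rfl

theorem sec_spineAut (b : B) (x : ZMod p) : sec (spineAut ω ρ b) [x] =
    if x = 0 then rootAut (ω b) else if x = -1 then spineAut ω ρ (ρ b) else 1 := by
  apply Subtype.ext
  ext1 w
  change (if x = 0 then rootFun (ω b) w else
    if x = -1 then spineFun ω ρ (ρ b) w else w) = _
  split_ifs <;> rfl

theorem rootAut_mem (k : ZMod p) : rootAut k ∈ groupOf ω ρ :=
  Subgroup.subset_closure (Or.inl ⟨k, rfl⟩)

theorem spineAut_mem (b : B) : spineAut ω ρ b ∈ groupOf ω ρ :=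
  Subgroup.subset_closure (Or.inr ⟨b, rfl⟩)

variable {ω ρ}

/-- The generating set of `G` is closed under inversion, so it suffices to check that a property
is stable under left multiplication by generators. -/
theorem groupOf_induction {P : TreeAut (ZMod p) → Prop} (one : P 1)
    (root : ∀ k, ∀ g ∈ groupOf ω ρ, P g → P (rootAut k * g))
    (spine : ∀ b, ∀ g ∈ groupOf ω ρ, P g → P (spineAut ω ρ b * g)) :
    ∀ g ∈ groupOf ω ρ, P g := by
  intro g hg
  refine Subgroup.closure_induction_left (p := fun g _ => P g) one ?_ ?_ hg
  · rintro _ (⟨k, rfl⟩ | ⟨b, rfl⟩) g hg h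
    · exact root k g hg h
    · exact spine b g hg h
  · rintro _ (⟨k, rfl⟩ | ⟨b, rfl⟩) g hg h
    · rw [← rootAut_neg]; exact root _ g hg h
    · rw [← spineAut_neg]; exact spine _ g hg h

/-- The conjugate `a^i b a^{-i}`, whose section at the letter `i` is `a^{ω(b)}`, whose section
at `i - 1` is `ρ(b)`, and whose other sections are trivial. -/
def shiftedSpine (ω : B →+ ZMod p) (ρ : B →+ B) (b : B) (i : ZMod p) : TreeAut (ZMod p) :=
  rootAut i * spineAut ω ρ b * (rootAut i)⁻¹

theorem shiftedSpine_mem (b : B) (i : ZMod p) : shiftedSpine ω ρ b i ∈ groupOf ω ρ :=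
  mul_mem (mul_mem (rootAut_mem ω ρ i) (spineAut_mem ω ρ b)) (inv_mem (rootAut_mem ω ρ i))

theorem shiftedSpine_mem_levelStab (b : B) (i : ZMod p) :
    shiftedSpine ω ρ b i ∈ levelStab (ZMod p) 1 := by
  refine mem_levelStab_one.2 fun x => ?_
  have h := mem_levelStab_one.1 (spineAut_mem_levelStab ω ρ b)
  rw [shiftedSpine, ← rootAut_neg, Subgroup.coe_mul, Subgroup.coe_mul, Equiv.Perm.mul_apply,
    Equiv.Perm.mul_apply, rootAut_apply, h, rootAut_apply]
  simp

theorem shiftedSpine_add (b c : B) (i : ZMod p) :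
    shiftedSpine ω ρ (b + c) i = shiftedSpine ω ρ b i * shiftedSpine ω ρ c i := by
  rw [shiftedSpine, shiftedSpine, shiftedSpine, spineAut_add]; group

theorem shiftedSpine_zero_left (i : ZMod p) : shiftedSpine ω ρ (0 : B) i = 1 := by
  rw [shiftedSpine, spineAut_zero]; group

theorem shiftedSpine_zero_right (b : B) : shiftedSpine ω ρ b 0 = spineAut ω ρ b := by
  rw [shiftedSpine, rootAut_zero]; group

theorem sec_shiftedSpine (b : B) (i x : ZMod p) : sec (shiftedSpine ω ρ b i) [x] =
    if x = i then rootAut (ω b) else if x = i - 1 then spineAut ω ρ (ρ b) else 1 := by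
  have h := sec_conj (rootAut i)
    (mem_levelStab_one.1 (spineAut_mem_levelStab ω ρ b) (x - i))
  rw [rootAut_apply, sub_add_cancel, sec_rootAut, sec_spineAut] at h
  have h2 : x - i = -1 ↔ x = i - 1 := by
    constructor
    · intro h; linear_combination h
    · intro h; linear_combination h
  simpa [shiftedSpine, sub_eq_zero, h2] using h

theorem sec_shiftedSpine_self (b : B) (i : ZMod p) :
    sec (shiftedSpine ω ρ b i) [i] = rootAut (ω b) := by
  rw [sec_shiftedSpine, if_pos rfl]

theorem sec_shiftedSpine_pred [Fact p.Prime] (b : B) (i : ZMod p) :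
    sec (shiftedSpine ω ρ b i) [i - 1] = spineAut ω ρ (ρ b) := by
  rw [sec_shiftedSpine, if_neg (by simp), if_pos rfl]

theorem sec_shiftedSpine_of_ne {b : B} {i x : ZMod p} (h : x ≠ i) (h' : x ≠ i - 1) :
    sec (shiftedSpine ω ρ b i) [x] = 1 := by
  rw [sec_shiftedSpine, if_neg h, if_neg h']

/-! ### Self-similarity and the action on letters -/

/-- The element `c` such that `g(0) = 0 + c`. Every element of `G` acts on the letters as
translation by this amount. -/
def label (g : TreeAut (ZMod p)) : ZMod p := (g.1 [0]).headD 0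

theorem label_eq {g : TreeAut (ZMod p)} {k : ZMod p} (h : ∀ x, g.1 [x] = [x + k]) :
    label g = k := by
  simp [label, h]

theorem apply_singleton {g : TreeAut (ZMod p)} (hg : g ∈ groupOf ω ρ) (x : ZMod p) :
    g.1 [x] = [x + label g] := by
  have key : ∃ k, ∀ x, g.1 [x] = [x + k] := by
    refine groupOf_induction (P := fun g => ∃ k, ∀ x, g.1 [x] = [x + k]) ?_ ?_ ?_ g hg
    · exact ⟨0, fun x => by rw [add_zero]; rfl⟩
    · rintro l g - ⟨k, hk⟩
      refine ⟨k + l, fun x => ?_⟩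
      rw [Subgroup.coe_mul, Equiv.Perm.mul_apply, hk, rootAut_apply, add_assoc]
    · rintro b g - ⟨k, hk⟩
      refine ⟨k, fun x => ?_⟩
      rw [Subgroup.coe_mul, Equiv.Perm.mul_apply, hk,
        mem_levelStab_one.1 (spineAut_mem_levelStab ω ρ b)]
  obtain ⟨k, hk⟩ := key
  rw [label_eq hk, hk]

theorem label_mul {g h : TreeAut (ZMod p)} (hg : g ∈ groupOf ω ρ) (hh : h ∈ groupOf ω ρ) :
    label (g * h) = label g + label h := by
  refine label_eq fun x => ?_
  rw [Subgroup.coe_mul, Equiv.Perm.mul_apply, apply_singleton hh, apply_singleton hg]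
  congr 1; ring

theorem label_rootAut (k : ZMod p) : label (rootAut k) = k := label_eq (rootAut_apply k)

theorem label_eq_zero_of_mem {g : TreeAut (ZMod p)} (hg : g ∈ levelStab (ZMod p) 1) :
    label g = 0 :=
  label_eq fun x => by rw [mem_levelStab_one.1 hg, add_zero]

theorem mem_levelStab_iff_label {g : TreeAut (ZMod p)} (hg : g ∈ groupOf ω ρ) :
    g ∈ levelStab (ZMod p) 1 ↔ label g = 0 := by
  refine ⟨label_eq_zero_of_mem, fun h => mem_levelStab_one.2 fun x => ?_⟩
  rw [apply_singleton hg, h, add_zero]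

theorem sec_mem {g : TreeAut (ZMod p)} (hg : g ∈ groupOf ω ρ) (x : ZMod p) :
    sec g [x] ∈ groupOf ω ρ := by
  refine groupOf_induction (P := fun g => ∀ x, sec g [x] ∈ groupOf ω ρ) ?_ ?_ ?_ g hg x
  · intro x; rw [sec_one]; exact one_mem _
  · intro k g hg h x
    rw [sec_mul, apply_singleton hg, sec_rootAut, one_mul]
    exact h x
  · intro b g hg h x
    rw [sec_mul, apply_singleton hg, sec_spineAut]
    refine mul_mem ?_ (h x)
    split_ifs
    exacts [rootAut_mem _ _ _, spineAut_mem _ _ _, one_mem _]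

theorem conj_mem_levelStab {g h : TreeAut (ZMod p)} (hg : g ∈ groupOf ω ρ)
    (hh : h ∈ levelStab (ZMod p) 1) : g * h * g⁻¹ ∈ levelStab (ZMod p) 1 := by
  refine mem_levelStab_one.2 fun x => ?_
  have e : g.1 [x - label g] = [x] := by rw [apply_singleton hg, sub_add_cancel]
  rw [← e, Subgroup.coe_mul, Subgroup.coe_mul, Equiv.Perm.mul_apply, Equiv.Perm.mul_apply,
    inv_apply_self, mem_levelStab_one.1 hh]

theorem sec_conj_of_mem {g h : TreeAut (ZMod p)} (hg : g ∈ groupOf ω ρ)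
    (hh : h ∈ levelStab (ZMod p) 1) (x : ZMod p) :
    sec (g * h * g⁻¹) [x] =
      sec g [x - label g] * sec h [x - label g] * (sec g [x - label g])⁻¹ := by
  have h1 := sec_conj g (mem_levelStab_one.1 hh (x - label g))
  rwa [apply_singleton hg, sub_add_cancel] at h1

end SpinalGroup

namespace SpinalGroup

open TreeAut

variable {p : ℕ} {B : Type*} [AddCommGroup B] {ω : B →+ ZMod p} {ρ : B →+ B}

/-! ### The abelianization -/

/-- The sum of the labels of the sections of `g` at all words of length `n`. -/
def labelSum [NeZero p] : ℕ → TreeAut (ZMod p) → ZMod p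
  | 0, g => label g
  | n + 1, g => ∑ x, labelSum n (sec g [x])

theorem labelSum_mul [NeZero p] (n : ℕ) {g h : TreeAut (ZMod p)} (hg : g ∈ groupOf ω ρ)
    (hh : h ∈ groupOf ω ρ) : labelSum n (g * h) = labelSum n g + labelSum n h := by
  induction n generalizing g h with
  | zero => exact label_mul hg hh
  | succ n ih =>
    have e : ∀ x, labelSum n (sec (g * h) [x]) =
        labelSum n (sec g [x + label h]) + labelSum n (sec h [x]) := by
      intro x
      rw [sec_mul, apply_singleton hh, ih (sec_mem hg _) (sec_mem hh _)]
    simp only [labelSum, e, Finset.sum_add_distrib]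
    congr 1
    exact Fintype.sum_equiv (Equiv.addRight (label h)) _ _ fun x => rfl

theorem labelSum_one [NeZero p] (n : ℕ) : labelSum n (1 : TreeAut (ZMod p)) = 0 := by
  induction n with
  | zero => exact label_eq_zero_of_mem (one_mem _)
  | succ n ih => simp [labelSum, sec_one, ih]

theorem labelSum_succ_rootAut [NeZero p] (n : ℕ) (k : ZMod p) :
    labelSum (n + 1) (rootAut k) = 0 := by
  simp [labelSum, sec_rootAut, labelSum_one]

theorem labelSum_spineAut [Fact p.Prime] (n : ℕ) (b : B) :
    labelSum (n + 1) (spineAut ω ρ b) = ω (ρ^[n] b) := by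
  have hne : (0 : ZMod p) ≠ -1 := by simp
  induction n generalizing b with
  | zero =>
    rw [labelSum, Finset.sum_eq_single 0]
    · rw [sec_spineAut, if_pos rfl]; exact label_rootAut _
    · intro x _ hx
      rw [sec_spineAut, if_neg hx]
      refine label_eq_zero_of_mem ?_
      split_ifs
      exacts [spineAut_mem_levelStab _ _ _, one_mem _]
    · simp
  | succ n ih =>
    rw [labelSum, Finset.sum_eq_single (-1)]
    · rw [sec_spineAut, if_neg hne.symm, if_pos rfl, ih, Function.iterate_succ_apply]
    · intro x _ hx
      rw [sec_spineAut, if_neg hx]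
      split_ifs
      exacts [labelSum_succ_rootAut n _, labelSum_one _]
    · simp

/-- The conditions on `(ω, ρ)` used below: `ρ` is bijective, no nonzero element of `B` has its
whole forward `ρ`-orbit in `ker ω` (so that `B` acts faithfully), and `ker ω` is not mapped
into itself by `ρ`. -/
structure IsNondegenerate (ω : B →+ ZMod p) (ρ : B →+ B) : Prop where
  bijective : Function.Bijective ρ
  faithful : ∀ b, (∀ n, ω (ρ^[n] b) = 0) → b = 0
  not_invariant : ∃ e, ω e = 0 ∧ ω (ρ e) = 1

variable [Fact p.Prime]

theorem exists_labelSum_eq {g : TreeAut (ZMod p)} (hg : g ∈ groupOf ω ρ) :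
    ∃ b : B, ∀ n, labelSum (n + 1) g = ω (ρ^[n] b) := by
  refine groupOf_induction (P := fun g => ∃ b : B, ∀ n, labelSum (n + 1) g = ω (ρ^[n] b))
    ?_ ?_ ?_ g hg
  · exact ⟨0, fun n => by rw [labelSum_one, iterate_map_zero, map_zero]⟩
  · rintro k g hg ⟨b, hb⟩
    refine ⟨b, fun n => ?_⟩
    rw [labelSum_mul _ (rootAut_mem ω ρ k) hg, hb, labelSum_succ_rootAut, zero_add]
  · rintro c g hg ⟨b, hb⟩
    refine ⟨c + b, fun n => ?_⟩
    rw [labelSum_mul _ (spineAut_mem ω ρ c) hg, hb, labelSum_spineAut, iterate_map_add, map_add]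

open Classical in
/-- The total exponent in `B` of an element `g` of `G`, characterized by
`ω(ρⁿ(spineDegree g)) = labelSum (n + 1) g` for all `n` (junk value `0` outside `G`). -/
noncomputable def spineDegree (ω : B →+ ZMod p) (ρ : B →+ B) (g : TreeAut (ZMod p)) : B :=
  if hg : g ∈ groupOf ω ρ then (exists_labelSum_eq hg).choose else 0

theorem apply_spineDegree {g : TreeAut (ZMod p)} (hg : g ∈ groupOf ω ρ) (n : ℕ) :
    ω (ρ^[n] (spineDegree ω ρ g)) = labelSum (n + 1) g := by
  rw [spineDegree, dif_pos hg]
  exact ((exists_labelSum_eq hg).choose_spec n).symm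

namespace IsNondegenerate

variable (h : IsNondegenerate ω ρ)
include h

theorem spineDegree_eq {g : TreeAut (ZMod p)} (hg : g ∈ groupOf ω ρ) {b : B}
    (hb : ∀ n, labelSum (n + 1) g = ω (ρ^[n] b)) : spineDegree ω ρ g = b := by
  refine sub_eq_zero.1 (h.faithful _ fun n => ?_)
  rw [iterate_map_sub, map_sub, apply_spineDegree hg, hb, sub_self]

theorem spineDegree_mul {g g' : TreeAut (ZMod p)} (hg : g ∈ groupOf ω ρ)
    (hg' : g' ∈ groupOf ω ρ) :
    spineDegree ω ρ (g * g') = spineDegree ω ρ g + spineDegree ω ρ g' :=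
  h.spineDegree_eq (mul_mem hg hg') fun n => by
    rw [iterate_map_add, map_add, apply_spineDegree hg, apply_spineDegree hg',
      labelSum_mul _ hg hg']

theorem spineDegree_rootAut (k : ZMod p) : spineDegree ω ρ (rootAut k) = 0 :=
  h.spineDegree_eq (rootAut_mem _ _ _) fun n => by
    rw [iterate_map_zero, map_zero, labelSum_succ_rootAut]

theorem spineDegree_spineAut (b : B) : spineDegree ω ρ (spineAut ω ρ b) = b :=
  h.spineDegree_eq (spineAut_mem _ _ _) fun n => labelSum_spineAut n b

theorem spineDegree_one : spineDegree ω ρ (1 : TreeAut (ZMod p)) = 0 := by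
  rw [← rootAut_zero]; exact h.spineDegree_rootAut 0

end IsNondegenerate

end SpinalGroup

namespace SpinalGroup

open TreeAut
open scoped commutatorElement

variable {p : ℕ} {B : Type*} [AddCommGroup B] {ω : B →+ ZMod p} {ρ : B →+ B}

/-! ### Subgroups normalized by `G` -/

/-- `H` is normalized by `G`, where `H` is any subgroup of `Aut(X^*)`. -/
def NormalizedBy (G H : Subgroup (TreeAut (ZMod p))) : Prop :=
  ∀ g ∈ G, ∀ h ∈ H, g * h * g⁻¹ ∈ H

theorem NormalizedBy.conj_inv {G H : Subgroup (TreeAut (ZMod p))} (hH : NormalizedBy G H)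
    {g h : TreeAut (ZMod p)} (hg : g ∈ G) (hh : h ∈ H) : g⁻¹ * h * g ∈ H := by
  simpa using hH g⁻¹ (inv_mem hg) h hh

theorem normalizedBy_commutator (G : Subgroup (TreeAut (ZMod p))) : NormalizedBy G ⁅G, G⁆ := by
  intro g hg h hh
  have h1 : ⁅g, h⁆ ∈ ⁅G, G⁆ :=
    Subgroup.commutator_mem_commutator hg (Subgroup.commutator_le_self G hh)
  have h2 := mul_mem h1 hh
  rwa [commutatorElement_def, inv_mul_cancel_right] at h2

theorem NormalizedBy.normal_subgroupOf {G H : Subgroup (TreeAut (ZMod p))}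
    (hH : NormalizedBy G H) : (H.subgroupOf G).Normal :=
  ⟨fun h hh g => hH g.1 g.2 h.1 hh⟩

/-- The commutator `[a^k, b] = a^{-k} b⁻¹ a^k b`. -/
def rootComm (ω : B →+ ZMod p) (ρ : B →+ B) (k : ZMod p) (b : B) : TreeAut (ZMod p) :=
  (rootAut k)⁻¹ * (spineAut ω ρ b)⁻¹ * rootAut k * spineAut ω ρ b

theorem rootComm_mem_commutator (k : ZMod p) (b : B) :
    rootComm ω ρ k b ∈ ⁅groupOf ω ρ, groupOf ω ρ⁆ := by
  have h : ⁅(rootAut k)⁻¹, (spineAut ω ρ b)⁻¹⁆ ∈ ⁅groupOf ω ρ, groupOf ω ρ⁆ :=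
    Subgroup.commutator_mem_commutator (inv_mem (rootAut_mem _ _ _))
      (inv_mem (spineAut_mem _ _ _))
  rwa [commutatorElement_def, inv_inv, inv_inv] at h

theorem rootComm_mem (k : ZMod p) (b : B) : rootComm ω ρ k b ∈ groupOf ω ρ :=
  Subgroup.commutator_le_self _ (rootComm_mem_commutator k b)

theorem rootComm_add_left (k l : ZMod p) (b : B) :
    rootComm ω ρ (k + l) b = (rootAut l)⁻¹ * rootComm ω ρ k b * rootAut l * rootComm ω ρ l b := by
  simp only [rootComm, rootAut_add]; group

theorem rootComm_add_right (k : ZMod p) (b c : B) :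
    rootComm ω ρ k (b + c) =
      rootComm ω ρ k c * ((spineAut ω ρ c)⁻¹ * rootComm ω ρ k b * spineAut ω ρ c) := by
  simp only [rootComm, spineAut_add]; group

theorem rootAut_mul_spineAut (k : ZMod p) (b : B) :
    rootAut k * spineAut ω ρ b = spineAut ω ρ b * rootAut k * rootComm ω ρ k b := by
  rw [rootComm]; group

theorem rootComm_mem_of_one {H : Subgroup (TreeAut (ZMod p))} [NeZero p]
    (hH : NormalizedBy (groupOf ω ρ) H) {b : B} (hb : rootComm ω ρ 1 b ∈ H) (k : ZMod p) :
    rootComm ω ρ k b ∈ H := by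
  obtain ⟨n, rfl⟩ : ∃ n : ℕ, (n : ZMod p) = k := ⟨k.val, ZMod.natCast_zmod_val k⟩
  induction n with
  | zero =>
    have : rootComm ω ρ ((0 : ℕ) : ZMod p) b = 1 := by
      rw [rootComm, Nat.cast_zero, rootAut_zero]; group
    rw [this]; exact one_mem H
  | succ n ih =>
    rw [Nat.cast_succ, rootComm_add_left]
    exact mul_mem (hH.conj_inv (rootAut_mem ω ρ 1) ih) hb

/-- Modulo a subgroup normalized by `G` and containing the commutators `[a, b]`, every element of
`G` is a product of an element of `B` and a power of `a`. -/
theorem exists_mem_of_rootComm_mem {H : Subgroup (TreeAut (ZMod p))} [NeZero p]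
    (hH : NormalizedBy (groupOf ω ρ) H) (hb : ∀ b, rootComm ω ρ 1 b ∈ H)
    {g : TreeAut (ZMod p)} (hg : g ∈ groupOf ω ρ) :
    ∃ b k, ∃ h ∈ H, g = spineAut ω ρ b * rootAut k * h := by
  refine groupOf_induction
    (P := fun g => ∃ b k, ∃ h ∈ H, g = spineAut ω ρ b * rootAut k * h) ?_ ?_ ?_ g hg
  · exact ⟨0, 0, 1, one_mem H, by rw [spineAut_zero, rootAut_zero]; group⟩
  · rintro l _ - ⟨b, k, h, hh, rfl⟩
    refine ⟨b, l + k, (rootAut k)⁻¹ * rootComm ω ρ l b * rootAut k * h,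
      mul_mem (hH.conj_inv (rootAut_mem ω ρ k) (rootComm_mem_of_one hH (hb b) l)) hh, ?_⟩
    simp only [← mul_assoc]
    rw [rootAut_mul_spineAut, rootAut_add]; group
  · rintro c _ - ⟨b, k, h, hh, rfl⟩
    exact ⟨c + b, k, h, hh, by rw [spineAut_add]; group⟩

/-! ### Geometric containment -/

/-- The subgroup of all `k` such that the tuple with `k` at `x` and `1` elsewhere is in
`ψ(K₁)`. -/
def liftable (K : Subgroup (TreeAut (ZMod p))) (x : ZMod p) : Subgroup (TreeAut (ZMod p)) :=
  ((K.subgroupOf (levelStab (ZMod p) 1)).map (psi (ZMod p))).comap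
    (MonoidHom.mulSingle (fun _ => TreeAut (ZMod p)) x)

theorem mem_liftable {K : Subgroup (TreeAut (ZMod p))} {x : ZMod p} {k : TreeAut (ZMod p)} :
    k ∈ liftable K x ↔ ∃ c ∈ K, c ∈ levelStab (ZMod p) 1 ∧ sec c [x] = k ∧
      ∀ y, y ≠ x → sec c [y] = 1 := by
  have hs := fun k' => Pi.mulSingle_eq_same (M := fun _ : ZMod p => TreeAut (ZMod p)) x k'
  have hn := fun k' y (hy : y ≠ x) =>
    Pi.mulSingle_eq_of_ne (M := fun _ : ZMod p => TreeAut (ZMod p)) hy k'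
  simp only [liftable, Subgroup.mem_comap, Subgroup.mem_map, Subgroup.mem_subgroupOf]
  constructor
  · rintro ⟨c, hcK, e⟩
    refine ⟨c.1, hcK, c.2, ?_, fun y hy => ?_⟩
    · exact (congrFun e x).trans (hs k)
    · exact (congrFun e y).trans (hn k y hy)
  · rintro ⟨c, hcK, hc, rfl, e⟩
    refine ⟨⟨c, hc⟩, hcK, funext fun y => ?_⟩
    obtain rfl | hy := eq_or_ne y x
    · exact (hs _).symm
    · exact (e y hy).trans (hn _ y hy).symm

theorem liftable_le {K : Subgroup (TreeAut (ZMod p))}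
    (hK : NormalizedBy (groupOf ω ρ) K) (x y : ZMod p) : liftable K x ≤ liftable K y := by
  intro k hk
  obtain ⟨c, hcK, hcs, rfl, hc⟩ := mem_liftable.1 hk
  have hr := rootAut_mem ω ρ (y - x)
  have e : ∀ z, sec (rootAut (y - x) * c * (rootAut (y - x))⁻¹) [z] = sec c [z - (y - x)] := by
    intro z
    rw [sec_conj_of_mem hr hcs, label_rootAut, sec_rootAut, one_mul, inv_one, mul_one]
  refine mem_liftable.2 ⟨_, hK _ hr c hcK, conj_mem_levelStab hr hcs, ?_, fun z hz => ?_⟩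
  · rw [e, sub_sub_cancel]
  · rw [e]
    refine hc _ fun hz' => hz ?_
    linear_combination hz'

theorem geometricallyContainsPower_of_le_liftable [NeZero p] {K : Subgroup (TreeAut (ZMod p))}
    (hK : NormalizedBy (groupOf ω ρ) K) {x : ZMod p} (hle : K ≤ liftable K x) :
    GeometricallyContainsPower K K := by
  refine geometricallyContainsPower_of_mulSingle fun y k hk => ?_
  obtain ⟨c, hcK, hcs, hck, hc⟩ := mem_liftable.1 (liftable_le hK x y (hle hk))
  refine ⟨c, hcK, hcs, fun z => ?_⟩
  obtain rfl | hz := eq_or_ne z y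
  · rw [hck, Pi.mulSingle_eq_same]
  · rw [hc z hz, Pi.mulSingle_eq_of_ne hz]

/-! ### The commutator subgroup -/

namespace IsNondegenerate

variable [Fact p.Prime]

/-- The homomorphism from `G` onto its abelianization `B × A`. -/
noncomputable def abHom (h : IsNondegenerate ω ρ) :
    groupOf ω ρ →* Multiplicative (B × ZMod p) where
  toFun g := Multiplicative.ofAdd (spineDegree ω ρ g.1, label g.1)
  map_one' := by
    rw [Subgroup.coe_one, h.spineDegree_one, label_eq_zero_of_mem (one_mem _)]; rfl
  map_mul' g g' := by
    rw [Subgroup.coe_mul, h.spineDegree_mul g.2 g'.2, label_mul g.2 g'.2]; rfl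

variable (h : IsNondegenerate ω ρ)
include h

theorem mem_ker_abHom {g : groupOf ω ρ} :
    g ∈ h.abHom.ker ↔ spineDegree ω ρ g.1 = 0 ∧ label g.1 = 0 := by
  rw [MonoidHom.mem_ker]
  exact Multiplicative.ofAdd.apply_eq_iff_eq.trans Prod.mk_inj

theorem abHom_surjective : Function.Surjective h.abHom := by
  rintro ⟨b, k⟩
  have hb := spineAut_mem ω ρ b
  have hk := rootAut_mem ω ρ k
  refine ⟨⟨_, mul_mem hb hk⟩, ?_⟩
  change (spineDegree ω ρ _, label _) = _
  rw [h.spineDegree_mul hb hk, h.spineDegree_spineAut, h.spineDegree_rootAut, add_zero,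
    label_mul hb hk, label_eq_zero_of_mem (spineAut_mem_levelStab ω ρ b), zero_add,
    label_rootAut]

theorem abelianization_eq_zero {g : TreeAut (ZMod p)}
    (hg : g ∈ ⁅groupOf ω ρ, groupOf ω ρ⁆) : spineDegree ω ρ g = 0 ∧ label g = 0 := by
  have hle : ⁅groupOf ω ρ, groupOf ω ρ⁆ ≤ h.abHom.ker.map (groupOf ω ρ).subtype := by
    rw [Subgroup.commutator_le]
    intro x hx y hy
    refine ⟨⁅(⟨x, hx⟩ : groupOf ω ρ), (⟨y, hy⟩ : groupOf ω ρ)⁆, ?_, rfl⟩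
    refine MonoidHom.mem_ker.2 ?_
    rw [map_commutatorElement, commutatorElement_eq_one_iff_mul_comm, mul_comm]
  obtain ⟨g', hg', rfl⟩ := hle hg
  exact h.mem_ker_abHom.1 hg'

theorem eq_of_abelianization_eq_zero {b : B} {k : ZMod p} {c g : TreeAut (ZMod p)}
    (hc : c ∈ ⁅groupOf ω ρ, groupOf ω ρ⁆) (hg : g = spineAut ω ρ b * rootAut k * c)
    (hd : spineDegree ω ρ g = 0) (hl : label g = 0) : g = c := by
  have hcG := Subgroup.commutator_le_self _ hc
  have hb' := spineAut_mem ω ρ b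
  have hk' := rootAut_mem ω ρ k
  rw [hg, h.spineDegree_mul (mul_mem hb' hk') hcG, h.spineDegree_mul hb' hk',
    (h.abelianization_eq_zero hc).1, h.spineDegree_spineAut, h.spineDegree_rootAut,
    add_zero, add_zero] at hd
  rw [hg, label_mul (mul_mem hb' hk') hcG, label_mul hb' hk', (h.abelianization_eq_zero hc).2,
    label_eq_zero_of_mem (spineAut_mem_levelStab ω ρ b), label_rootAut, zero_add, add_zero] at hl
  rw [hg, hd, hl, spineAut_zero, rootAut_zero, one_mul, one_mul]

theorem mem_of_abelianization_eq_zero {H : Subgroup (TreeAut (ZMod p))}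
    (hH : NormalizedBy (groupOf ω ρ) H) (hb : ∀ b, rootComm ω ρ 1 b ∈ H)
    (hHle : H ≤ ⁅groupOf ω ρ, groupOf ω ρ⁆) {g : TreeAut (ZMod p)} (hg : g ∈ groupOf ω ρ)
    (hd : spineDegree ω ρ g = 0) (hl : label g = 0) : g ∈ H := by
  obtain ⟨b, k, c, hc, e⟩ := exists_mem_of_rootComm_mem hH hb hg
  rwa [h.eq_of_abelianization_eq_zero (hHle hc) e hd hl]

theorem mem_commutator_iff {g : TreeAut (ZMod p)} :
    g ∈ ⁅groupOf ω ρ, groupOf ω ρ⁆ ↔ g ∈ groupOf ω ρ ∧ spineDegree ω ρ g = 0 ∧ label g = 0 :=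
  ⟨fun hg => ⟨Subgroup.commutator_le_self _ hg, h.abelianization_eq_zero hg⟩, fun hg =>
    h.mem_of_abelianization_eq_zero (normalizedBy_commutator _)
      (fun b => rootComm_mem_commutator 1 b) le_rfl hg.1 hg.2.1 hg.2.2⟩

/-- `G'` is the smallest subgroup that is normalized by `G` and contains every `[a, b]`. -/
theorem commutator_le {H : Subgroup (TreeAut (ZMod p))} (hH : NormalizedBy (groupOf ω ρ) H)
    (hb : ∀ b, rootComm ω ρ 1 b ∈ H) : ⁅groupOf ω ρ, groupOf ω ρ⁆ ≤ H := by
  intro g hg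
  obtain ⟨hG, hd, hl⟩ := h.mem_commutator_iff.1 hg
  have := h.mem_of_abelianization_eq_zero (H := H ⊓ ⁅groupOf ω ρ, groupOf ω ρ⁆)
    (fun x hx y hy => ⟨hH x hx y hy.1, normalizedBy_commutator _ x hx y hy.2⟩)
    (fun b => ⟨hb b, rootComm_mem_commutator 1 b⟩) inf_le_right hG hd hl
  exact this.1

theorem relIndex_commutator :
    Subgroup.relIndex ⁅groupOf ω ρ, groupOf ω ρ⁆ (groupOf ω ρ) = Nat.card B * p := by
  have e : Subgroup.subgroupOf ⁅groupOf ω ρ, groupOf ω ρ⁆ (groupOf ω ρ) = h.abHom.ker := by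
    ext g
    rw [Subgroup.mem_subgroupOf, h.mem_commutator_iff, h.mem_ker_abHom]
    exact and_iff_right g.2
  rw [Subgroup.relIndex, e, Subgroup.index_ker, MonoidHom.range_eq_top.2 h.abHom_surjective,
    Subgroup.card_top, Nat.card_congr Multiplicative.toAdd, Nat.card_prod, Nat.card_zmod]

theorem commutator_le_levelStab :
    ⁅groupOf ω ρ, groupOf ω ρ⁆ ≤ levelStab (ZMod p) 1 := by
  intro g hg
  obtain ⟨hG, -, hl⟩ := h.mem_commutator_iff.1 hg
  exact (mem_levelStab_iff_label hG).2 hl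

theorem relIndex_levelStab :
    (groupOf ω ρ ⊓ levelStab (ZMod p) 1).relIndex (groupOf ω ρ) = p := by
  let q : groupOf ω ρ →* Multiplicative (ZMod p) :=
    (AddMonoidHom.toMultiplicative (AddMonoidHom.snd B (ZMod p))).comp h.abHom
  have hq : Function.Surjective q := by
    intro k
    obtain ⟨g, hg⟩ := h.abHom_surjective (Multiplicative.ofAdd (0, k.toAdd))
    refine ⟨g, ?_⟩
    change AddMonoidHom.toMultiplicative (AddMonoidHom.snd B (ZMod p)) (h.abHom g) = k
    rw [hg]; rfl
  have e : (groupOf ω ρ ⊓ levelStab (ZMod p) 1).subgroupOf (groupOf ω ρ) = q.ker := by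
    ext g
    rw [Subgroup.mem_subgroupOf, Subgroup.mem_inf, mem_levelStab_iff_label g.2,
      MonoidHom.mem_ker]
    exact (and_iff_right g.2).trans Multiplicative.ofAdd.apply_eq_iff_eq.symm
  rw [Subgroup.relIndex, e, Subgroup.index_ker, MonoidHom.range_eq_top.2 hq,
    Subgroup.card_top, Nat.card_congr Multiplicative.toAdd, Nat.card_zmod]

/-! ### Self-replication and transitivity on levels -/

theorem omega_surjective (k : ZMod p) : ∃ b, ω b = k := by
  obtain ⟨e, -, he⟩ := h.not_invariant
  refine ⟨k.val • ρ e, ?_⟩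
  rw [map_nsmul, he, nsmul_eq_mul, mul_one, ZMod.natCast_zmod_val]

/-- `G` is self-replicating: every element of `G` is the section at `x` of an element of the
first level stabilizer. -/
theorem exists_sec_eq {g : TreeAut (ZMod p)} (hg : g ∈ groupOf ω ρ) (x : ZMod p) :
    ∃ c ∈ groupOf ω ρ, c ∈ levelStab (ZMod p) 1 ∧ sec c [x] = g := by
  refine groupOf_induction
    (P := fun g => ∃ c ∈ groupOf ω ρ, c ∈ levelStab (ZMod p) 1 ∧ sec c [x] = g) ?_ ?_ ?_ g hg
  · exact ⟨1, one_mem _, one_mem _, sec_one _⟩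
  · rintro k _ - ⟨c, hc, hcs, rfl⟩
    obtain ⟨b, rfl⟩ := h.omega_surjective k
    refine ⟨shiftedSpine ω ρ b x * c, mul_mem (shiftedSpine_mem b x) hc,
      mul_mem (shiftedSpine_mem_levelStab b x) hcs, ?_⟩
    rw [sec_mul_of_mem hcs, sec_shiftedSpine_self]
  · rintro b _ - ⟨c, hc, hcs, rfl⟩
    obtain ⟨b, rfl⟩ := h.bijective.2 b
    refine ⟨shiftedSpine ω ρ b (x + 1) * c, mul_mem (shiftedSpine_mem b _) hc,
      mul_mem (shiftedSpine_mem_levelStab b _) hcs, ?_⟩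
    have := sec_shiftedSpine_pred (ω := ω) (ρ := ρ) b (x + 1)
    rw [add_sub_cancel_right] at this
    rw [sec_mul_of_mem hcs, this]

theorem sphericallyTransitive : SphericallyTransitive (groupOf ω ρ) := by
  intro u
  induction u with
  | nil =>
    intro v hv
    obtain rfl : v = [] := List.eq_nil_of_length_eq_zero hv.symm
    exact ⟨1, one_mem _, rfl⟩
  | cons x u ih =>
    intro v hv
    cases v with
    | nil => simp at hv
    | cons y v =>
      obtain ⟨g, hg, hgu⟩ := ih v (by simpa using hv)
      obtain ⟨c, hc, hcs, rfl⟩ := h.exists_sec_eq hg x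
      refine ⟨rootAut (y - x) * c, mul_mem (rootAut_mem _ _ _) hc, ?_⟩
      have e := apply_append_sec c [x] u
      rw [mem_levelStab_one.1 hcs, hgu] at e
      rw [Subgroup.coe_mul, Equiv.Perm.mul_apply]
      change (rootAut (y - x)).1 (c.1 ([x] ++ u)) = _
      rw [e]
      change (x + (y - x)) :: v = y :: v
      rw [add_sub_cancel]

theorem normalizedBy_liftable {K : Subgroup (TreeAut (ZMod p))}
    (hK : NormalizedBy (groupOf ω ρ) K) (x : ZMod p) :
    NormalizedBy (groupOf ω ρ) (liftable K x) := by
  intro g hg k hk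
  obtain ⟨c, hcK, hcs, rfl, hc⟩ := mem_liftable.1 hk
  obtain ⟨d, hd, hds, rfl⟩ := h.exists_sec_eq hg x
  have e : ∀ y, sec (d * c * d⁻¹) [y] = sec d [y] * sec c [y] * (sec d [y])⁻¹ := by
    intro y
    rw [sec_conj_of_mem hd hcs, label_eq_zero_of_mem hds, sub_zero]
  refine mem_liftable.2 ⟨d * c * d⁻¹, hK d hd c hcK, conj_mem_levelStab hd hcs, e x, ?_⟩
  intro y hy
  rw [e, hc y hy, mul_one, mul_inv_cancel]

end IsNondegenerate

end SpinalGroup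

namespace SpinalGroup

open TreeAut
open scoped commutatorElement

variable {p : ℕ} {B : Type*} [AddCommGroup B] {ω : B →+ ZMod p} {ρ : B →+ B}

/-! ### The first level stabilizer -/

/-- The first level stabilizer of `G` is generated by the conjugates `a^i b a^{-i}`. -/
theorem levelStab_induction {P : TreeAut (ZMod p) → Prop} (one : P 1)
    (mul : ∀ b i, ∀ g ∈ groupOf ω ρ, g ∈ levelStab (ZMod p) 1 → P g →
      P (shiftedSpine ω ρ b i * g)) :
    ∀ g ∈ groupOf ω ρ, g ∈ levelStab (ZMod p) 1 → P g := by
  have key : ∀ g ∈ groupOf ω ρ, ∃ c ∈ groupOf ω ρ, c ∈ levelStab (ZMod p) 1 ∧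
      (∀ k, P (rootAut k * c * (rootAut k)⁻¹)) ∧ ∃ j, g = c * rootAut j := by
    refine groupOf_induction ?_ ?_ ?_
    · refine ⟨1, one_mem _, one_mem _, fun k => ?_, 0, ?_⟩
      · rwa [mul_one, mul_inv_cancel]
      · rw [rootAut_zero, mul_one]
    · rintro l _ - ⟨c, hc, hcs, hP, j, rfl⟩
      have hl := rootAut_mem ω ρ l
      refine ⟨rootAut l * c * (rootAut l)⁻¹, mul_mem (mul_mem hl hc) (inv_mem hl),
        conj_mem_levelStab hl hcs, fun k => ?_, l + j, ?_⟩
      · have := hP (k + l)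
        rw [rootAut_add] at this
        convert this using 1
        group
      · rw [rootAut_add]; group
    · rintro b _ - ⟨c, hc, hcs, hP, j, rfl⟩
      refine ⟨spineAut ω ρ b * c, mul_mem (spineAut_mem _ _ b) hc,
        mul_mem (spineAut_mem_levelStab _ _ b) hcs, fun k => ?_, j, by group⟩
      have hk := rootAut_mem ω ρ k
      have := mul b k _ (mul_mem (mul_mem hk hc) (inv_mem hk)) (conj_mem_levelStab hk hcs) (hP k)
      convert this using 1
      rw [shiftedSpine]; group
  intro g hg hgs
  obtain ⟨c, hc, hcs, hP, j, rfl⟩ := key g hg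
  have hj : label (c * rootAut j) = j := by
    rw [label_mul hc (rootAut_mem ω ρ j), label_eq_zero_of_mem hcs, label_rootAut, zero_add]
  rw [label_eq_zero_of_mem hgs] at hj
  have := hP 0
  rw [rootAut_zero, one_mul, inv_one, mul_one] at this
  rwa [← hj, rootAut_zero, mul_one]

namespace IsNondegenerate

variable [Fact p.Prime]

/-- The homomorphism from the first level stabilizer of `G` to `B × ⋯ × B` given by the
`B`-exponents of the sections. -/
noncomputable def secDegree (h : IsNondegenerate ω ρ) :
    (groupOf ω ρ ⊓ levelStab (ZMod p) 1 : Subgroup (TreeAut (ZMod p))) →*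
      Multiplicative (ZMod p → B) where
  toFun g := Multiplicative.ofAdd fun x => spineDegree ω ρ (sec g.1 [x])
  map_one' := by
    refine congrArg Multiplicative.ofAdd (funext fun x => ?_)
    rw [Subgroup.coe_one, sec_one, h.spineDegree_one]; rfl
  map_mul' g g' := by
    refine congrArg Multiplicative.ofAdd (funext fun x => ?_)
    rw [Subgroup.coe_mul, sec_mul_of_mem g'.2.2, h.spineDegree_mul (sec_mem g.2.1 x)
      (sec_mem g'.2.1 x)]
    rfl

variable (h : IsNondegenerate ω ρ)
include h

/-- For `g` in the first level stabilizer, the image of the section at `x` in `A` is determined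
by the image of the section at `x - 1` in `B`. -/
theorem exists_spineDegree_sec {g : TreeAut (ZMod p)} (hg : g ∈ groupOf ω ρ)
    (hgs : g ∈ levelStab (ZMod p) 1) :
    ∃ c : ZMod p → B, ∀ x, spineDegree ω ρ (sec g [x - 1]) = ρ (c x) ∧
      label (sec g [x]) = ω (c x) := by
  refine levelStab_induction (P := fun g => ∃ c : ZMod p → B, ∀ x,
    spineDegree ω ρ (sec g [x - 1]) = ρ (c x) ∧ label (sec g [x]) = ω (c x)) ?_ ?_ g hg hgs
  · refine ⟨0, fun x => ?_⟩
    rw [sec_one, sec_one, h.spineDegree_one, label_eq_zero_of_mem (one_mem _)]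
    simp
  · rintro b i g hg hgs ⟨c, hc⟩
    refine ⟨Pi.single i b + c, fun x => ?_⟩
    have hb := sec_mem (shiftedSpine_mem (ω := ω) (ρ := ρ) b i)
    rw [sec_mul_of_mem hgs, sec_mul_of_mem hgs, h.spineDegree_mul (hb _) (sec_mem hg _),
      label_mul (hb _) (sec_mem hg _), (hc x).1, (hc x).2, Pi.add_apply, map_add, map_add]
    constructor <;> congr 1
    · obtain rfl | hx := eq_or_ne x i
      · rw [sec_shiftedSpine_pred, h.spineDegree_spineAut, Pi.single_eq_same]
      · have hx' : x - 1 ≠ i - 1 := fun e => hx (sub_left_injective e)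
        rw [sec_shiftedSpine, if_neg hx', Pi.single_eq_of_ne hx, map_zero]
        split_ifs
        exacts [h.spineDegree_rootAut _, h.spineDegree_one]
    · obtain rfl | hx := eq_or_ne x i
      · rw [sec_shiftedSpine_self, label_rootAut, Pi.single_eq_same]
      · rw [sec_shiftedSpine, if_neg hx, Pi.single_eq_of_ne hx, map_zero]
        refine label_eq_zero_of_mem ?_
        split_ifs
        exacts [spineAut_mem_levelStab _ _ _, one_mem _]

theorem secDegree_surjective : Function.Surjective h.secDegree := by
  have key : ∀ f : ZMod p → B, Multiplicative.ofAdd f ∈ h.secDegree.range := by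
    intro f
    let S : AddSubgroup (ZMod p → B) := Subgroup.toAddSubgroup' h.secDegree.range
    change f ∈ S
    refine AddSubgroup.pi_mem_of_single_mem f fun i => ?_
    obtain ⟨b, hb⟩ := h.bijective.2 (f i)
    refine ⟨⟨shiftedSpine ω ρ b (i + 1), shiftedSpine_mem _ _, shiftedSpine_mem_levelStab _ _⟩,
      funext fun x => ?_⟩
    change spineDegree ω ρ (sec (shiftedSpine ω ρ b (i + 1)) [x]) =
      (Pi.single i (f i) : ZMod p → B) x
    obtain rfl | hx := eq_or_ne x i
    · have := sec_shiftedSpine_pred (ω := ω) (ρ := ρ) b (x + 1)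
      rw [add_sub_cancel_right] at this
      rw [this, h.spineDegree_spineAut, hb, Pi.single_eq_same]
    · rw [sec_shiftedSpine, add_sub_cancel_right, if_neg hx, Pi.single_eq_of_ne hx]
      split_ifs
      exacts [h.spineDegree_rootAut _, h.spineDegree_one]
  exact fun f => key f.toAdd

theorem psiPreimage_commutator_iff {g : TreeAut (ZMod p)} (hg : g ∈ groupOf ω ρ)
    (hgs : g ∈ levelStab (ZMod p) 1) :
    g ∈ psiPreimage (groupOf ω ρ) ⁅groupOf ω ρ, groupOf ω ρ⁆ ↔
      ∀ x, spineDegree ω ρ (sec g [x]) = 0 := by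
  rw [mem_psiPreimage]
  refine ⟨fun hg x => (h.mem_commutator_iff.1 (hg.2.2 x)).2.1, fun hd => ⟨hg, hgs, fun x => ?_⟩⟩
  refine h.mem_commutator_iff.2 ⟨sec_mem hg x, hd x, ?_⟩
  obtain ⟨c, hc⟩ := h.exists_spineDegree_sec hg hgs
  have h0 : ρ (c x) = ρ 0 := by rw [← (hc x).1, hd, map_zero]
  rw [(hc x).2, h.bijective.1 h0, map_zero]

theorem relIndex_psiPreimage_commutator :
    (psiPreimage (groupOf ω ρ) ⁅groupOf ω ρ, groupOf ω ρ⁆).relIndex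
      (groupOf ω ρ ⊓ levelStab (ZMod p) 1) = Nat.card B ^ p := by
  have e : (psiPreimage (groupOf ω ρ) ⁅groupOf ω ρ, groupOf ω ρ⁆).subgroupOf
      (groupOf ω ρ ⊓ levelStab (ZMod p) 1) = h.secDegree.ker := by
    ext g
    rw [Subgroup.mem_subgroupOf, h.psiPreimage_commutator_iff g.2.1 g.2.2, MonoidHom.mem_ker]
    exact funext_iff.symm
  rw [Subgroup.relIndex, e, Subgroup.index_ker, MonoidHom.range_eq_top.2 h.secDegree_surjective,
    Subgroup.card_top, Nat.card_congr Multiplicative.toAdd, Nat.card_fun, Nat.card_zmod]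

theorem relIndex_commutator_levelStab :
    Subgroup.relIndex ⁅groupOf ω ρ, groupOf ω ρ⁆ (groupOf ω ρ ⊓ levelStab (ZMod p) 1) =
      Nat.card B := by
  have e := Subgroup.relIndex_mul_relIndex ⁅groupOf ω ρ, groupOf ω ρ⁆
    (groupOf ω ρ ⊓ levelStab (ZMod p) 1) (groupOf ω ρ)
    (le_inf (Subgroup.commutator_le_self _) h.commutator_le_levelStab) inf_le_left
  rw [h.relIndex_commutator, h.relIndex_levelStab] at e
  exact Nat.eq_of_mul_eq_mul_right (Fact.out : p.Prime).pos e

theorem isRegularBranchOver {K : Subgroup (TreeAut (ZMod p))} (hle : K ≤ groupOf ω ρ)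
    (hK : NormalizedBy (groupOf ω ρ) K) (hi : K.relIndex (groupOf ω ρ) ≠ 0)
    (hg : GeometricallyContainsPower K K) : IsRegularBranchOver (groupOf ω ρ) K where
  spherically_transitive := h.sphericallyTransitive
  le := hle
  normal := hK.normal_subgroupOf
  finite_index := ⟨hi⟩
  geometrically_contains := hg

/-! ### Odd primes -/

/-- For `p` odd, `{0, -1}` and `{1, 0}` meet only in `0`, so the commutator of an element of `B`
with a conjugate by `a` of another one has a single nontrivial section. -/
theorem geometricallyContainsPower_commutator (hp : p ≠ 2) :
    GeometricallyContainsPower ⁅groupOf ω ρ, groupOf ω ρ⁆ ⁅groupOf ω ρ, groupOf ω ρ⁆ := by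
  have hN := normalizedBy_commutator (groupOf ω ρ)
  refine geometricallyContainsPower_of_le_liftable hN (x := 0) (h.commutator_le
    (h.normalizedBy_liftable hN 0) fun b => ?_)
  obtain ⟨e, he⟩ := h.omega_surjective 1
  obtain ⟨c, rfl⟩ := h.bijective.2 b
  have hu := shiftedSpine_mem_levelStab (ω := ω) (ρ := ρ) e 0
  have hv := shiftedSpine_mem_levelStab (ω := ω) (ρ := ρ) c 1
  have hv0 := sec_shiftedSpine_pred (ω := ω) (ρ := ρ) c 1
  rw [sub_self] at hv0
  have hs : ∀ y, sec ((shiftedSpine ω ρ e 0)⁻¹ * (shiftedSpine ω ρ c 1)⁻¹ *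
      shiftedSpine ω ρ e 0 * shiftedSpine ω ρ c 1) [y] =
      (sec (shiftedSpine ω ρ e 0) [y])⁻¹ * (sec (shiftedSpine ω ρ c 1) [y])⁻¹ *
      sec (shiftedSpine ω ρ e 0) [y] * sec (shiftedSpine ω ρ c 1) [y] := by
    intro y
    rw [sec_mul_of_mem hv, sec_mul_of_mem hu, sec_mul_of_mem (inv_mem hv), sec_inv_of_mem hu,
      sec_inv_of_mem hv]
  refine mem_liftable.2 ⟨(shiftedSpine ω ρ e 0)⁻¹ * (shiftedSpine ω ρ c 1)⁻¹ *
    shiftedSpine ω ρ e 0 * shiftedSpine ω ρ c 1, ?_, ?_, ?_, ?_⟩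
  · have := Subgroup.commutator_mem_commutator
      (inv_mem (shiftedSpine_mem (ω := ω) (ρ := ρ) e 0))
      (inv_mem (shiftedSpine_mem (ω := ω) (ρ := ρ) c 1))
    rwa [commutatorElement_def, inv_inv, inv_inv] at this
  · exact mul_mem (mul_mem (mul_mem (inv_mem hu) (inv_mem hv)) hu) hv
  · rw [hs, sec_shiftedSpine_self, he, hv0, rootComm]
  · intro y hy
    rw [hs]
    obtain rfl | hy1 := eq_or_ne y 1
    · have h1 : (1 : ZMod p) ≠ 0 - 1 := by
        rw [zero_sub]
        intro h1
        have h2 : ((2 : ℕ) : ZMod p) = 0 := by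
          push_cast
          linear_combination h1
        exact hp ((Nat.prime_dvd_prime_iff_eq Fact.out Nat.prime_two).1
          ((ZMod.natCast_eq_zero_iff 2 p).1 h2))
      rw [sec_shiftedSpine_of_ne hy h1]; group
    · rw [sec_shiftedSpine_of_ne hy1 (by rwa [sub_self])]; group

theorem relIndex_psiPreimage_commutator_commutator (hp : p ≠ 2) {m : ℕ}
    (hB : Nat.card B = p ^ m) :
    (psiPreimage (groupOf ω ρ) ⁅groupOf ω ρ, groupOf ω ρ⁆).relIndex
      ⁅groupOf ω ρ, groupOf ω ρ⁆ = p ^ (m * (p - 1)) := by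
  have hp0 := (Fact.out : p.Prime).pos
  have e := Subgroup.relIndex_mul_relIndex _ _ (groupOf ω ρ ⊓ levelStab (ZMod p) 1)
    (psiPreimage_le (G := groupOf ω ρ) (h.geometricallyContainsPower_commutator hp))
    (le_inf (Subgroup.commutator_le_self _) h.commutator_le_levelStab)
  rw [h.relIndex_psiPreimage_commutator, h.relIndex_commutator_levelStab, hB] at e
  refine Nat.eq_of_mul_eq_mul_right (pow_pos hp0 m) (e.trans ?_)
  rw [← pow_mul, ← pow_add, ← Nat.mul_succ, Nat.succ_eq_add_one, Nat.sub_add_cancel hp0]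

end IsNondegenerate

end SpinalGroup

namespace SpinalGroup

open TreeAut
open scoped commutatorElement

/-! ### The subgroup `K` -/

section BranchK

variable {p : ℕ} {B : Type*} [AddCommGroup B] {ω : B →+ ZMod p} {ρ : B →+ B}

theorem branchK_le {H : Subgroup (TreeAut (ZMod p))} (hH : NormalizedBy (groupOf ω ρ) H)
    (hb : ∀ b, ω b = 0 → rootComm ω ρ 1 (ρ b) ∈ H) : branchK ω ρ ≤ H := by
  have hn := hH.normal_subgroupOf
  refine Subgroup.map_le_iff_le_comap.2 (Subgroup.normalClosure_le_normal (N := H.subgroupOf _) ?_)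
  rintro g ⟨_, ⟨b, hb', rfl⟩, e⟩
  change g.1 ∈ H
  rw [e]
  exact hb b hb'

theorem rootComm_mem_branchK {b : B} (hb : ω b = 0) : rootComm ω ρ 1 (ρ b) ∈ branchK ω ρ :=
  ⟨⟨_, rootComm_mem 1 (ρ b)⟩, Subgroup.subset_normalClosure ⟨_, ⟨b, hb, rfl⟩, rfl⟩, rfl⟩

theorem normalizedBy_branchK : NormalizedBy (groupOf ω ρ) (branchK ω ρ) := by
  rintro g hg _ ⟨k, hk, rfl⟩
  exact ⟨⟨g, hg⟩ * k * ⟨g, hg⟩⁻¹, Subgroup.normalClosure_normal.conj_mem k hk _, rfl⟩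

end BranchK

/-! ### Commutators in the first level stabilizer of the binary tree -/

section SpineComm

variable {B : Type*} [AddCommGroup B] {ω : B →+ ZMod 2} {ρ : B →+ B}

/-- The commutator of the generators `a c a⁻¹` and `b` of the first level stabilizer. -/
def spineComm (ω : B →+ ZMod 2) (ρ : B →+ B) (b c : B) : TreeAut (ZMod 2) :=
  (shiftedSpine ω ρ c 1)⁻¹ * (shiftedSpine ω ρ b 0)⁻¹ * shiftedSpine ω ρ c 1 *
    shiftedSpine ω ρ b 0

theorem spineComm_mem_commutator (b c : B) :
    spineComm ω ρ b c ∈ ⁅groupOf ω ρ, groupOf ω ρ⁆ := by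
  have := Subgroup.commutator_mem_commutator
    (inv_mem (shiftedSpine_mem (ω := ω) (ρ := ρ) c 1))
    (inv_mem (shiftedSpine_mem (ω := ω) (ρ := ρ) b 0))
  rwa [commutatorElement_def, inv_inv, inv_inv] at this

theorem sec_spineComm (b c : B) (x : ZMod 2) : sec (spineComm ω ρ b c) [x] =
    (sec (shiftedSpine ω ρ c 1) [x])⁻¹ * (sec (shiftedSpine ω ρ b 0) [x])⁻¹ *
      sec (shiftedSpine ω ρ c 1) [x] * sec (shiftedSpine ω ρ b 0) [x] := by
  have hu := shiftedSpine_mem_levelStab (ω := ω) (ρ := ρ) b 0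
  have hv := shiftedSpine_mem_levelStab (ω := ω) (ρ := ρ) c 1
  rw [spineComm, sec_mul_of_mem hu, sec_mul_of_mem hv, sec_mul_of_mem (inv_mem hu),
    sec_inv_of_mem hu, sec_inv_of_mem hv]

theorem sec_spineComm_one (b c : B) :
    sec (spineComm ω ρ b c) [1] = rootComm ω ρ (ω c) (ρ b) := by
  have e := sec_shiftedSpine_pred (ω := ω) (ρ := ρ) b 0
  have h1 : (0 : ZMod 2) - 1 = 1 := rfl
  rw [h1] at e
  rw [sec_spineComm, e, sec_shiftedSpine_self, rootComm]

theorem sec_spineComm_zero (b c : B) :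
    sec (spineComm ω ρ b c) [0] = (rootComm ω ρ (ω b) (ρ c))⁻¹ := by
  have e := sec_shiftedSpine_pred (ω := ω) (ρ := ρ) c 1
  rw [sub_self] at e
  rw [sec_spineComm, e, sec_shiftedSpine_self, rootComm]
  group

theorem sec_spineComm_mem_commutator (b c : B) (x : ZMod 2) :
    sec (spineComm ω ρ b c) [x] ∈ ⁅groupOf ω ρ, groupOf ω ρ⁆ := by
  obtain rfl | rfl : x = 0 ∨ x = 1 := by revert x; decide
  · rw [sec_spineComm_zero]; exact inv_mem (rootComm_mem_commutator _ _)
  · rw [sec_spineComm_one]; exact rootComm_mem_commutator _ _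

/-- If `H` is normalized by `G` and contains the commutators of the generators `b` and `a c a⁻¹`
of the first level stabilizer, then every element of the latter is, modulo `H`, a product of
two such generators. -/
theorem exists_mem_of_spineComm_mem {H : Subgroup (TreeAut (ZMod 2))}
    (hH : NormalizedBy (groupOf ω ρ) H) (hc : ∀ b c, spineComm ω ρ b c ∈ H)
    {g : TreeAut (ZMod 2)} (hg : g ∈ groupOf ω ρ) (hgs : g ∈ levelStab (ZMod 2) 1) :
    ∃ b c, ∃ k ∈ H, g = shiftedSpine ω ρ b 0 * shiftedSpine ω ρ c 1 * k := by
  refine levelStab_induction (P := fun g => ∃ b c, ∃ k ∈ H,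
    g = shiftedSpine ω ρ b 0 * shiftedSpine ω ρ c 1 * k) ?_ ?_ g hg hgs
  · exact ⟨0, 0, 1, one_mem _, by rw [shiftedSpine_zero_left, shiftedSpine_zero_left]; group⟩
  · rintro b' i _ - - ⟨b, c, k, hk, rfl⟩
    obtain rfl | rfl : i = 0 ∨ i = 1 := by revert i; decide
    · exact ⟨b' + b, c, k, hk, by rw [shiftedSpine_add]; group⟩
    · refine ⟨b, b' + c, _, mul_mem (hH.conj_inv (shiftedSpine_mem c 1) (hc b b')) hk, ?_⟩
      rw [shiftedSpine_add, spineComm]; group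

end SpineComm

/-! ### The description of `K` by a character -/

namespace IsNondegenerate

variable {B : Type*} [AddCommGroup B] {ω : B →+ ZMod 2} {ρ : B →+ B}

/-- The functional `ω ∘ ρ⁻¹` on `B`, whose kernel is `B₁ = ρ(ker ω)`. -/
noncomputable def omegaInv (h : IsNondegenerate ω ρ) : B →+ ZMod 2 :=
  ω.comp (AddEquiv.ofBijective ρ h.bijective).symm.toAddMonoidHom

theorem omegaInv_rho (h : IsNondegenerate ω ρ) (b : B) : h.omegaInv (ρ b) = ω b :=
  congrArg ω ((AddEquiv.ofBijective ρ h.bijective).symm_apply_apply b)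

/-- A character `G → ℤ/2` with `a ↦ 1` and `ρ(b) ↦ ω(b) + ω(ρ⁻¹(b))`. It is chosen so that the
two sections of `[a, b]` are both sent to `ω(ρ⁻¹(b))`, which vanishes exactly on `B₁`. -/
noncomputable def character (h : IsNondegenerate ω ρ) (g : TreeAut (ZMod 2)) : ZMod 2 :=
  let ρ' := (AddEquiv.ofBijective ρ h.bijective).symm
  h.omegaInv (spineDegree ω ρ g) + h.omegaInv (ρ' (spineDegree ω ρ g)) + label g

/-- The value of `character` on the section at `0`. On `G'` it is a `G`-invariant homomorphism
with kernel `K`. -/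
noncomputable def secCharacter (h : IsNondegenerate ω ρ) (g : TreeAut (ZMod 2)) : ZMod 2 :=
  h.character (sec g [0])

variable (h : IsNondegenerate ω ρ)
include h

theorem character_mul {g g' : TreeAut (ZMod 2)} (hg : g ∈ groupOf ω ρ) (hg' : g' ∈ groupOf ω ρ) :
    h.character (g * g') = h.character g + h.character g' := by
  simp only [character, h.spineDegree_mul hg hg', label_mul hg hg', map_add]
  abel

theorem character_one : h.character 1 = 0 := by
  simp [character, h.spineDegree_one, label_eq_zero_of_mem (one_mem _)]

theorem character_inv {g : TreeAut (ZMod 2)} (hg : g ∈ groupOf ω ρ) :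
    h.character g⁻¹ = h.character g := by
  have e := h.character_mul (inv_mem hg) hg
  rw [inv_mul_cancel, h.character_one] at e
  exact CharTwo.add_eq_zero.1 e.symm

theorem character_conj {g k : TreeAut (ZMod 2)} (hg : g ∈ groupOf ω ρ) (hk : k ∈ groupOf ω ρ) :
    h.character (g * k * g⁻¹) = h.character k := by
  rw [h.character_mul (mul_mem hg hk) (inv_mem hg), h.character_mul hg hk, h.character_inv hg,
    add_right_comm, CharTwo.add_self_eq_zero, zero_add]

theorem character_rootAut (k : ZMod 2) : h.character (rootAut k) = k := by
  simp [character, h.spineDegree_rootAut, label_rootAut]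

theorem character_spineAut (b : B) :
    h.character (spineAut ω ρ (ρ b)) = ω b + h.omegaInv b := by
  have e : (AddEquiv.ofBijective ρ h.bijective).symm (ρ b) = b :=
    (AddEquiv.ofBijective ρ h.bijective).symm_apply_apply b
  simp only [character, h.spineDegree_spineAut, h.omegaInv_rho, e,
    label_eq_zero_of_mem (spineAut_mem_levelStab ω ρ _), add_zero]

/-- Both sections of `[a, b]` have the same image under `character`. -/
theorem character_sec_rootComm (b : B) (x : ZMod 2) :
    h.character (sec (rootComm ω ρ 1 b) [x]) = h.omegaInv b := by
  have e : rootComm ω ρ 1 b = (shiftedSpine ω ρ b (-1))⁻¹ * shiftedSpine ω ρ b 0 := by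
    rw [rootComm, shiftedSpine, shiftedSpine_zero_right, rootAut_neg]; group
  have hs := shiftedSpine_mem (ω := ω) (ρ := ρ)
  have hst := shiftedSpine_mem_levelStab (ω := ω) (ρ := ρ)
  have h1 : (0 : ZMod 2) - 1 = 1 := rfl
  have h2 : (-1 : ZMod 2) = 1 := rfl
  rw [e, sec_mul_of_mem (hst b 0), sec_inv_of_mem (hst b (-1)),
    h.character_mul (inv_mem (sec_mem (hs b _) x)) (sec_mem (hs b 0) x),
    h.character_inv (sec_mem (hs b _) x), h2]
  obtain rfl | rfl : x = 0 ∨ x = 1 := by revert x; decide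
  · have e1 := sec_shiftedSpine_pred (ω := ω) (ρ := ρ) b 1
    rw [sub_self] at e1
    rw [e1, sec_shiftedSpine_self, h.character_spineAut, h.character_rootAut, add_right_comm,
      CharTwo.add_self_eq_zero, zero_add]
  · have e1 := sec_shiftedSpine_pred (ω := ω) (ρ := ρ) b 0
    rw [h1] at e1
    rw [e1, sec_shiftedSpine_self, h.character_spineAut, h.character_rootAut, ← add_assoc,
      CharTwo.add_self_eq_zero, zero_add]

theorem character_sec_conj {g k : TreeAut (ZMod 2)} (hg : g ∈ groupOf ω ρ)
    (hk : k ∈ groupOf ω ρ) (hks : k ∈ levelStab (ZMod 2) 1) (x : ZMod 2) :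
    h.character (sec (g * k * g⁻¹) [x]) = h.character (sec k [x - label g]) := by
  rw [sec_conj_of_mem hg hks, h.character_conj (sec_mem hg _) (sec_mem hk _)]

theorem character_sec_mul {g k : TreeAut (ZMod 2)} (hg : g ∈ groupOf ω ρ)
    (hk : k ∈ groupOf ω ρ) (hks : k ∈ levelStab (ZMod 2) 1) (x : ZMod 2) :
    h.character (sec (g * k) [x]) = h.character (sec g [x]) + h.character (sec k [x]) := by
  rw [sec_mul_of_mem hks, h.character_mul (sec_mem hg x) (sec_mem hk x)]

theorem character_sec_inv {k : TreeAut (ZMod 2)}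
    (hk : k ∈ groupOf ω ρ) (hks : k ∈ levelStab (ZMod 2) 1) (x : ZMod 2) :
    h.character (sec k⁻¹ [x]) = h.character (sec k [x]) := by
  rw [sec_inv_of_mem hks, h.character_inv (sec_mem hk x)]

/-- On `G'` the value of `character` on the sections does not depend on the letter. -/
theorem character_sec_eq {g : TreeAut (ZMod 2)} (hg : g ∈ ⁅groupOf ω ρ, groupOf ω ρ⁆)
    (x : ZMod 2) : h.character (sec g [x]) = h.secCharacter g := by
  let J : Subgroup (TreeAut (ZMod 2)) :=
    { carrier := {g | g ∈ groupOf ω ρ ∧ g ∈ levelStab (ZMod 2) 1 ∧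
        ∀ x, h.character (sec g [x]) = h.secCharacter g}
      one_mem' := ⟨one_mem _, one_mem _, fun x => by rw [secCharacter, sec_one, sec_one]⟩
      mul_mem' := fun {g k} hg hk => ⟨mul_mem hg.1 hk.1, mul_mem hg.2.1 hk.2.1, fun x => by
        rw [secCharacter, h.character_sec_mul hg.1 hk.1 hk.2.1,
          h.character_sec_mul hg.1 hk.1 hk.2.1, hg.2.2, hk.2.2, hg.2.2 0, hk.2.2 0]⟩
      inv_mem' := fun {g} hg => ⟨inv_mem hg.1, inv_mem hg.2.1, fun x => by
        rw [secCharacter, h.character_sec_inv hg.1 hg.2.1, h.character_sec_inv hg.1 hg.2.1,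
          hg.2.2, hg.2.2 0]⟩ }
  have hJ : NormalizedBy (groupOf ω ρ) J := fun g hg k hk =>
    ⟨mul_mem (mul_mem hg hk.1) (inv_mem hg), conj_mem_levelStab hg hk.2.1, fun x => by
      rw [secCharacter, h.character_sec_conj hg hk.1 hk.2.1, h.character_sec_conj hg hk.1 hk.2.1,
        hk.2.2, hk.2.2 (0 - _)]⟩
  have hle := h.commutator_le hJ fun b =>
    ⟨rootComm_mem 1 b, h.commutator_le_levelStab (rootComm_mem_commutator 1 b), fun x => by
      rw [secCharacter, h.character_sec_rootComm, h.character_sec_rootComm]⟩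
  exact (hle hg).2.2 x

theorem secCharacter_one : h.secCharacter 1 = 0 := by
  rw [secCharacter, sec_one, h.character_one]

theorem secCharacter_mul {g k : TreeAut (ZMod 2)} (hg : g ∈ ⁅groupOf ω ρ, groupOf ω ρ⁆)
    (hk : k ∈ ⁅groupOf ω ρ, groupOf ω ρ⁆) :
    h.secCharacter (g * k) = h.secCharacter g + h.secCharacter k :=
  h.character_sec_mul (Subgroup.commutator_le_self _ hg) (Subgroup.commutator_le_self _ hk)
    (h.commutator_le_levelStab hk) 0

theorem secCharacter_inv {g : TreeAut (ZMod 2)} (hg : g ∈ ⁅groupOf ω ρ, groupOf ω ρ⁆) :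
    h.secCharacter g⁻¹ = h.secCharacter g :=
  h.character_sec_inv (Subgroup.commutator_le_self _ hg) (h.commutator_le_levelStab hg) 0

theorem secCharacter_conj {g k : TreeAut (ZMod 2)} (hg : g ∈ groupOf ω ρ)
    (hk : k ∈ ⁅groupOf ω ρ, groupOf ω ρ⁆) :
    h.secCharacter (g * k * g⁻¹) = h.secCharacter k := by
  rw [secCharacter, h.character_sec_conj hg (Subgroup.commutator_le_self _ hk)
    (h.commutator_le_levelStab hk), h.character_sec_eq hk]

theorem secCharacter_rootComm (k : ZMod 2) (b : B) :
    h.secCharacter (rootComm ω ρ k b) = k * h.omegaInv b := by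
  obtain rfl | rfl : k = 0 ∨ k = 1 := by revert k; decide
  · have : rootComm ω ρ 0 b = 1 := by rw [rootComm, rootAut_zero]; group
    rw [this, h.secCharacter_one, zero_mul]
  · rw [one_mul]; exact h.character_sec_rootComm b 0

theorem add_self_eq_zero (b : B) : b + b = 0 :=
  h.faithful _ fun n => by rw [iterate_map_add, map_add, CharTwo.add_self_eq_zero]

/-- `ker ω` is not contained in `B₁ = ρ(ker ω)`: this is where `ρ` not preserving `ker ω` is used
in describing `G / K`. -/
theorem exists_omega_eq_zero_omegaInv_eq_one : ∃ d, ω d = 0 ∧ h.omegaInv d = 1 := by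
  obtain ⟨e, he, he'⟩ := h.not_invariant
  obtain hc | hc : ω (ρ (ρ e)) = 0 ∨ ω (ρ (ρ e)) = 1 := by
    generalize ω (ρ (ρ e)) = k; revert k; decide
  · exact ⟨ρ (ρ e), hc, by rw [h.omegaInv_rho, he']⟩
  · refine ⟨ρ (ρ e + e), ?_, ?_⟩
    · rw [map_add, map_add, hc, he', CharTwo.add_self_eq_zero]
    · rw [h.omegaInv_rho, map_add, he', he, add_zero]

theorem rootComm_mem_branchK_of_omegaInv {b : B} (hb : h.omegaInv b = 0) :
    rootComm ω ρ 1 b ∈ branchK ω ρ := by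
  obtain ⟨c, rfl⟩ := h.bijective.2 b
  rw [h.omegaInv_rho] at hb
  exact rootComm_mem_branchK hb

/-- If `ω(d) = 0`, then `d` is supported below the last letter, so it commutes with `a⁻¹ d a` and
`[a, d]` is an involution. -/
theorem rootComm_mul_self {d : B} (hd : ω d = 0) :
    rootComm ω ρ 1 d * rootComm ω ρ 1 d = 1 := by
  have hmem := h.commutator_le_levelStab (rootComm_mem_commutator (ω := ω) (ρ := ρ) 1 d)
  have hst := shiftedSpine_mem_levelStab (ω := ω) (ρ := ρ)
  have e : rootComm ω ρ 1 d = shiftedSpine ω ρ d 1 * shiftedSpine ω ρ d 0 := by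
    have h2 : (-1 : ZMod 2) = 1 := rfl
    have h3 : (spineAut ω ρ d)⁻¹ = spineAut ω ρ d := by
      rw [← spineAut_neg, neg_eq_of_add_eq_zero_left (h.add_self_eq_zero d)]
    rw [rootComm, shiftedSpine_zero_right, shiftedSpine, h3, ← rootAut_neg, h2]
  refine ext_of_mem (mul_mem hmem hmem) (one_mem _) fun x => ?_
  rw [sec_mul_of_mem hmem, e, sec_mul_of_mem (hst d 0), sec_one, sec_shiftedSpine,
    sec_shiftedSpine, hd, rootAut_zero, sub_self, zero_sub]
  have h2 : (-1 : ZMod 2) = 1 := rfl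
  rw [h2]
  have h4 : spineAut ω ρ (ρ d) * spineAut ω ρ (ρ d) = 1 := by
    rw [← spineAut_add, h.add_self_eq_zero, spineAut_zero]
  obtain rfl | rfl : x = 0 ∨ x = 1 := by revert x; decide
  · simp [h4]
  · simp [h4]

theorem commute_rootComm_rootAut {d : B} (hd : ω d = 0) (k : ZMod 2) :
    Commute (rootComm ω ρ 1 d) (rootAut k) := by
  obtain rfl | rfl : k = 0 ∨ k = 1 := by revert k; decide
  · rw [rootAut_zero]; exact Commute.one_right _
  · have ha : (rootAut (1 : ZMod 2))⁻¹ = rootAut 1 := by rw [← rootAut_neg]; rfl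
    have ht := eq_inv_of_mul_eq_one_left (h.rootComm_mul_self hd)
    have e : rootAut 1 * rootComm ω ρ 1 d * (rootAut 1)⁻¹ = (rootComm ω ρ 1 d)⁻¹ := by
      calc _ = (spineAut ω ρ d)⁻¹ * rootAut 1 * spineAut ω ρ d * (rootAut 1)⁻¹ := by
            rw [rootComm]; group
        _ = (spineAut ω ρ d)⁻¹ * (rootAut 1)⁻¹ * spineAut ω ρ d * rootAut 1 := by rw [ha]
        _ = _ := by rw [rootComm]; group
    rw [← ht] at e
    exact (mul_inv_eq_iff_eq_mul.1 e).symm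

theorem exists_rootComm_eq {d : B} (hd' : h.omegaInv d = 1) (b : B) :
    ∃ i : ℕ, ∃ c ∈ branchK ω ρ, rootComm ω ρ 1 b = rootComm ω ρ 1 d ^ i * c := by
  obtain hb | hb : h.omegaInv b = 0 ∨ h.omegaInv b = 1 := by
    generalize h.omegaInv b = k; revert k; decide
  · exact ⟨0, _, h.rootComm_mem_branchK_of_omegaInv hb, by rw [pow_zero, one_mul]⟩
  · refine ⟨1, _, normalizedBy_branchK.conj_inv (spineAut_mem ω ρ d)
      (h.rootComm_mem_branchK_of_omegaInv (b := b - d) ?_), ?_⟩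
    · rw [map_sub, hb, hd', sub_self]
    · rw [pow_one, ← rootComm_add_right, sub_add_cancel]

/-- Modulo `K`, every element of `G` is of the form `b a^k [a, d]^n`. -/
theorem exists_mem_branchK {d : B} (hd : ω d = 0) (hd' : h.omegaInv d = 1)
    {g : TreeAut (ZMod 2)} (hg : g ∈ groupOf ω ρ) :
    ∃ b k, ∃ n : ℕ, ∃ c ∈ branchK ω ρ,
      g = spineAut ω ρ b * rootAut k * (rootComm ω ρ 1 d ^ n * c) := by
  refine groupOf_induction (P := fun g => ∃ b k, ∃ n : ℕ, ∃ c ∈ branchK ω ρ,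
      g = spineAut ω ρ b * rootAut k * (rootComm ω ρ 1 d ^ n * c)) ?_ ?_ ?_ g hg
  · exact ⟨0, 0, 0, 1, one_mem _, by rw [spineAut_zero, rootAut_zero]; group⟩
  · rintro l _ - ⟨b, k, n, c, hc, rfl⟩
    obtain rfl | rfl : l = 0 ∨ l = 1 := by revert l; decide
    · exact ⟨b, k, n, c, hc, by rw [rootAut_zero, one_mul]⟩
    obtain ⟨i, c', hc', e⟩ := h.exists_rootComm_eq hd' b
    have hmem : rootAut k * rootComm ω ρ 1 d ^ n ∈ groupOf ω ρ :=
      mul_mem (rootAut_mem _ _ k) (pow_mem (rootComm_mem 1 d) n)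
    refine ⟨b, 1 + k, i + n, _, mul_mem (normalizedBy_branchK.conj_inv hmem hc') hc, ?_⟩
    have hcomm := ((h.commute_rootComm_rootAut hd k).pow_left i).eq
    calc rootAut 1 * (spineAut ω ρ b * rootAut k * (rootComm ω ρ 1 d ^ n * c))
        = rootAut 1 * spineAut ω ρ b * rootAut k * rootComm ω ρ 1 d ^ n * c := by group
      _ = spineAut ω ρ b * rootAut 1 * (rootComm ω ρ 1 d ^ i * rootAut k) *
            ((rootAut k)⁻¹ * c' * rootAut k) * rootComm ω ρ 1 d ^ n * c := by
          rw [rootAut_mul_spineAut, e]; group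
      _ = _ := by rw [hcomm, rootAut_add, pow_add]; group
  · rintro c' _ - ⟨b, k, n, c, hc, rfl⟩
    exact ⟨c' + b, k, n, c, hc, by rw [spineAut_add]; group⟩

/-- `K` is the kernel of `secCharacter` on `G'`: it is contained in the kernel because the kernel
is normalized by `G` and contains the generators of `K`; conversely an element of `G'` is
`[a, d]ⁿ` modulo `K`, and `n` is even if `secCharacter` vanishes. -/
theorem mem_branchK_iff {g : TreeAut (ZMod 2)} :
    g ∈ branchK ω ρ ↔ g ∈ ⁅groupOf ω ρ, groupOf ω ρ⁆ ∧ h.secCharacter g = 0 := by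
  let H : Subgroup (TreeAut (ZMod 2)) :=
    { carrier := {g | g ∈ ⁅groupOf ω ρ, groupOf ω ρ⁆ ∧ h.secCharacter g = 0}
      one_mem' := ⟨one_mem _, h.secCharacter_one⟩
      mul_mem' := fun {g k} hg hk => ⟨mul_mem hg.1 hk.1, by
        rw [h.secCharacter_mul hg.1 hk.1, hg.2, hk.2, add_zero]⟩
      inv_mem' := fun {g} hg => ⟨inv_mem hg.1, by rw [h.secCharacter_inv hg.1, hg.2]⟩ }
  have hle : branchK ω ρ ≤ H := by
    refine branchK_le (fun g hg k hk => ⟨normalizedBy_commutator _ g hg k hk.1, ?_⟩) fun b hb =>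
      ⟨rootComm_mem_commutator _ _, ?_⟩
    · rw [h.secCharacter_conj hg hk.1, hk.2]
    · rw [h.secCharacter_rootComm, h.omegaInv_rho, hb, mul_zero]
  refine ⟨fun hg => hle hg, fun ⟨hg, hg0⟩ => ?_⟩
  obtain ⟨d, hd, hd'⟩ := h.exists_omega_eq_zero_omegaInv_eq_one
  obtain ⟨hG, hdeg, hl⟩ := h.mem_commutator_iff.1 hg
  obtain ⟨b, k, n, c, hc, e⟩ := h.exists_mem_branchK hd hd' hG
  have ht := rootComm_mem_commutator (ω := ω) (ρ := ρ) 1 d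
  have htn : ∀ n : ℕ, h.secCharacter (rootComm ω ρ 1 d ^ n) = n := by
    intro n
    induction n with
    | zero => rw [pow_zero, h.secCharacter_one, Nat.cast_zero]
    | succ n ih =>
      rw [pow_succ, h.secCharacter_mul (pow_mem ht n) ht, ih, h.secCharacter_rootComm, hd',
        one_mul, Nat.cast_succ]
  have e' := h.eq_of_abelianization_eq_zero (mul_mem (pow_mem ht n) (hle hc).1) e hdeg hl
  rw [e', h.secCharacter_mul (pow_mem ht n) (hle hc).1, (hle hc).2, add_zero, htn,
    ZMod.natCast_eq_zero_iff] at hg0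
  obtain ⟨j, rfl⟩ := hg0
  rw [e', pow_mul, pow_two, h.rootComm_mul_self hd, one_pow, one_mul]
  exact hc

theorem branchK_le_commutator : branchK ω ρ ≤ ⁅groupOf ω ρ, groupOf ω ρ⁆ :=
  fun _ hg => (h.mem_branchK_iff.1 hg).1

theorem relIndex_branchK_commutator :
    (branchK ω ρ).relIndex ⁅groupOf ω ρ, groupOf ω ρ⁆ = 2 := by
  let q : (⁅groupOf ω ρ, groupOf ω ρ⁆ : Subgroup (TreeAut (ZMod 2))) →*
      Multiplicative (ZMod 2) :=
    { toFun := fun g => Multiplicative.ofAdd (h.secCharacter g.1)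
      map_one' := congrArg Multiplicative.ofAdd h.secCharacter_one
      map_mul' := fun g k => congrArg Multiplicative.ofAdd (h.secCharacter_mul g.2 k.2) }
  have hq : Function.Surjective q := by
    intro k
    obtain ⟨d, -, hd⟩ := h.exists_omega_eq_zero_omegaInv_eq_one
    exact ⟨⟨_, rootComm_mem_commutator k.toAdd d⟩, congrArg Multiplicative.ofAdd
      ((h.secCharacter_rootComm _ _).trans (by rw [hd, mul_one]; rfl))⟩
  have e : (branchK ω ρ).subgroupOf ⁅groupOf ω ρ, groupOf ω ρ⁆ = q.ker := by
    ext g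
    rw [Subgroup.mem_subgroupOf, h.mem_branchK_iff, MonoidHom.mem_ker]
    exact (and_iff_right g.2).trans Multiplicative.ofAdd.apply_eq_iff_eq.symm
  rw [Subgroup.relIndex, e, Subgroup.index_ker, MonoidHom.range_eq_top.2 hq,
    Subgroup.card_top, Nat.card_congr Multiplicative.toAdd, Nat.card_zmod]

theorem relIndex_branchK : (branchK ω ρ).relIndex (groupOf ω ρ) = Nat.card B * 4 := by
  rw [← Subgroup.relIndex_mul_relIndex _ _ _ h.branchK_le_commutator
    (Subgroup.commutator_le_self _), h.relIndex_branchK_commutator, h.relIndex_commutator]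
  ring

/-! ### Indices for `p = 2` -/

/-- For `ω(b) = 0` and `ω(e) = 1` the commutator `spineComm b e` has `[a, ρ(b)]` as its only
nontrivial section. -/
theorem geometricallyContainsPower_branchK :
    GeometricallyContainsPower (branchK ω ρ) (branchK ω ρ) := by
  have hN := normalizedBy_branchK (ω := ω) (ρ := ρ)
  refine geometricallyContainsPower_of_le_liftable hN (x := 1) (branchK_le
    (h.normalizedBy_liftable hN 1) fun b hb => ?_)
  obtain ⟨e, he⟩ := h.omega_surjective 1
  have h0 : sec (spineComm ω ρ b e) [0] = 1 := by
    rw [sec_spineComm_zero, hb, rootComm, rootAut_zero]; group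
  refine mem_liftable.2 ⟨spineComm ω ρ b e, ?_, ?_, ?_, ?_⟩
  · refine h.mem_branchK_iff.2 ⟨spineComm_mem_commutator b e, ?_⟩
    rw [secCharacter, h0, h.character_one]
  · exact h.commutator_le_levelStab (spineComm_mem_commutator b e)
  · rw [sec_spineComm_one, he]
  · intro y hy
    obtain rfl : y = 0 := by revert y; decide
    exact h0

theorem secCharacter_sec_spineComm (b c : B) (x : ZMod 2) :
    h.secCharacter (sec (spineComm ω ρ b c) [x]) = ω b * ω c := by
  obtain rfl | rfl : x = 0 ∨ x = 1 := by revert x; decide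
  · rw [sec_spineComm_zero, h.secCharacter_inv (rootComm_mem_commutator _ _),
      h.secCharacter_rootComm, h.omegaInv_rho]
  · rw [sec_spineComm_one, h.secCharacter_rootComm, h.omegaInv_rho, mul_comm]

/-- If both sections of an element of the first level stabilizer lie in `G'`, then they lie in the
same coset of `K`: modulo the subgroup of elements with this property, the generators of the
stabilizer commute, and by `spineDegree` the only remaining product is the trivial one. -/
theorem secCharacter_sec_eq {g : TreeAut (ZMod 2)}
    (hg : g ∈ psiPreimage (groupOf ω ρ) ⁅groupOf ω ρ, groupOf ω ρ⁆) (x : ZMod 2) :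
    h.secCharacter (sec g [x]) = h.secCharacter (sec g [0]) := by
  let L : Subgroup (TreeAut (ZMod 2)) :=
    { carrier := {g | g ∈ groupOf ω ρ ∧ g ∈ levelStab (ZMod 2) 1 ∧
        (∀ x, sec g [x] ∈ ⁅groupOf ω ρ, groupOf ω ρ⁆) ∧
        ∀ x, h.secCharacter (sec g [x]) = h.secCharacter (sec g [0])}
      one_mem' := ⟨one_mem _, one_mem _, fun x => by rw [sec_one]; exact one_mem _,
        fun x => by rw [sec_one, sec_one]⟩
      mul_mem' := by
        rintro g k ⟨hg, hgs, hg', hgx⟩ ⟨hk, hks, hk', hkx⟩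
        refine ⟨mul_mem hg hk, mul_mem hgs hks, fun x => ?_, fun x => ?_⟩
        · rw [sec_mul_of_mem hks]; exact mul_mem (hg' x) (hk' x)
        · rw [sec_mul_of_mem hks, sec_mul_of_mem hks, h.secCharacter_mul (hg' x) (hk' x),
            h.secCharacter_mul (hg' 0) (hk' 0), hgx, hkx]
      inv_mem' := by
        rintro g ⟨hg, hgs, hg', hgx⟩
        refine ⟨inv_mem hg, inv_mem hgs, fun x => ?_, fun x => ?_⟩
        · rw [sec_inv_of_mem hgs]; exact inv_mem (hg' x)
        · rw [sec_inv_of_mem hgs, sec_inv_of_mem hgs, h.secCharacter_inv (hg' x),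
            h.secCharacter_inv (hg' 0), hgx] }
  have hL : NormalizedBy (groupOf ω ρ) L := by
    rintro g hg k ⟨hk, hks, hk', hkx⟩
    refine ⟨mul_mem (mul_mem hg hk) (inv_mem hg), conj_mem_levelStab hg hks, fun x => ?_,
      fun x => ?_⟩
    · rw [sec_conj_of_mem hg hks]
      exact normalizedBy_commutator _ _ (sec_mem hg _) _ (hk' _)
    · rw [sec_conj_of_mem hg hks, sec_conj_of_mem hg hks, h.secCharacter_conj (sec_mem hg _)
        (hk' _), h.secCharacter_conj (sec_mem hg _) (hk' _), hkx, hkx (0 - _)]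
  have hc : ∀ b c, spineComm ω ρ b c ∈ L := fun b c =>
    ⟨Subgroup.commutator_le_self _ (spineComm_mem_commutator b c),
      h.commutator_le_levelStab (spineComm_mem_commutator b c),
      sec_spineComm_mem_commutator b c, fun x => by
        rw [h.secCharacter_sec_spineComm, h.secCharacter_sec_spineComm]⟩
  obtain ⟨hG, hGs, hg'⟩ := mem_psiPreimage.1 hg
  obtain ⟨b, c, k, hk, e⟩ := exists_mem_of_spineComm_mem hL hc hG hGs
  have hu := shiftedSpine_mem (ω := ω) (ρ := ρ) b 0
  have hv := shiftedSpine_mem (ω := ω) (ρ := ρ) c 1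
  have hvs := shiftedSpine_mem_levelStab (ω := ω) (ρ := ρ) c 1
  have hdeg : ∀ x, spineDegree ω ρ (sec (shiftedSpine ω ρ b 0) [x]) +
      spineDegree ω ρ (sec (shiftedSpine ω ρ c 1) [x]) = 0 := by
    intro x
    have e1 := (h.mem_commutator_iff.1 (hg' x)).2.1
    rwa [e, sec_mul_of_mem hk.2.1, sec_mul_of_mem hvs,
      h.spineDegree_mul (mul_mem (sec_mem hu x) (sec_mem hv x)) (sec_mem hk.1 x),
      h.spineDegree_mul (sec_mem hu x) (sec_mem hv x),
      (h.mem_commutator_iff.1 (hk.2.2.1 x)).2.1, add_zero] at e1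
  have hb : b = 0 := by
    have e1 := hdeg (0 - 1)
    have h1 : (0 : ZMod 2) - 1 = 1 := rfl
    rw [sec_shiftedSpine_pred, h1, sec_shiftedSpine_self, h.spineDegree_spineAut,
      h.spineDegree_rootAut, add_zero] at e1
    exact h.bijective.1 (e1.trans (map_zero ρ).symm)
  have hc : c = 0 := by
    have e1 := hdeg (1 - 1)
    rw [sec_shiftedSpine_pred, sub_self, sec_shiftedSpine_self, h.spineDegree_spineAut,
      h.spineDegree_rootAut, zero_add] at e1
    exact h.bijective.1 (e1.trans (map_zero ρ).symm)
  rw [hb, hc, shiftedSpine_zero_left, shiftedSpine_zero_left, one_mul, one_mul] at e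
  rw [e]
  exact hk.2.2.2 x

theorem relIndex_psiPreimage_branchK :
    (psiPreimage (groupOf ω ρ) (branchK ω ρ)).relIndex
      (psiPreimage (groupOf ω ρ) ⁅groupOf ω ρ, groupOf ω ρ⁆) = 2 := by
  have hM : ∀ g : psiPreimage (groupOf ω ρ) ⁅groupOf ω ρ, groupOf ω ρ⁆, _ :=
    fun g => mem_psiPreimage.1 g.2
  let q : psiPreimage (groupOf ω ρ) ⁅groupOf ω ρ, groupOf ω ρ⁆ →* Multiplicative (ZMod 2) :=
    { toFun := fun g => Multiplicative.ofAdd (h.secCharacter (sec g.1 [0]))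
      map_one' := by
        rw [Subgroup.coe_one, sec_one, h.secCharacter_one]; rfl
      map_mul' := fun g k => by
        rw [Subgroup.coe_mul, sec_mul_of_mem (hM k).2.1,
          h.secCharacter_mul ((hM g).2.2 0) ((hM k).2.2 0)]
        rfl }
  have hq : Function.Surjective q := by
    intro k
    obtain ⟨b, hb⟩ := h.omega_surjective k.toAdd
    obtain ⟨c, hc⟩ := h.omega_surjective 1
    refine ⟨⟨spineComm ω ρ b c, mem_psiPreimage.2
      ⟨Subgroup.commutator_le_self _ (spineComm_mem_commutator b c),
        h.commutator_le_levelStab (spineComm_mem_commutator b c),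
        sec_spineComm_mem_commutator b c⟩⟩, congrArg Multiplicative.ofAdd
      ((h.secCharacter_sec_spineComm b c 0).trans (by rw [hb, hc, mul_one]; rfl))⟩
  have e : (psiPreimage (groupOf ω ρ) (branchK ω ρ)).subgroupOf
      (psiPreimage (groupOf ω ρ) ⁅groupOf ω ρ, groupOf ω ρ⁆) = q.ker := by
    ext g
    rw [Subgroup.mem_subgroupOf, MonoidHom.mem_ker]
    refine Iff.trans ?_ Multiplicative.ofAdd.apply_eq_iff_eq.symm
    rw [mem_psiPreimage]
    refine ⟨fun hg => (h.mem_branchK_iff.1 (hg.2.2 0)).2, fun hg => ⟨(hM g).1, (hM g).2.1,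
      fun x => h.mem_branchK_iff.2 ⟨(hM g).2.2 x, ?_⟩⟩⟩
    rw [h.secCharacter_sec_eq g.2, hg]
  rw [Subgroup.relIndex, e, Subgroup.index_ker, MonoidHom.range_eq_top.2 hq,
    Subgroup.card_top, Nat.card_congr Multiplicative.toAdd, Nat.card_zmod]

theorem relIndex_psiPreimage_branchK_branchK [Finite B] :
    (psiPreimage (groupOf ω ρ) (branchK ω ρ)).relIndex (branchK ω ρ) = Nat.card B := by
  have e1 := Subgroup.relIndex_mul_relIndex _ _ (groupOf ω ρ ⊓ levelStab (ZMod 2) 1)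
    (psiPreimage_mono (G := groupOf ω ρ) h.branchK_le_commutator)
    fun g hg => ⟨(mem_psiPreimage.1 hg).1, (mem_psiPreimage.1 hg).2.1⟩
  have hle := le_inf (Subgroup.commutator_le_self (groupOf ω ρ)) h.commutator_le_levelStab
  have e2 := Subgroup.relIndex_mul_relIndex _ _ (groupOf ω ρ ⊓ levelStab (ZMod 2) 1)
    h.branchK_le_commutator hle
  have e3 := Subgroup.relIndex_mul_relIndex _ _ (groupOf ω ρ ⊓ levelStab (ZMod 2) 1)
    (psiPreimage_le (G := groupOf ω ρ) h.geometricallyContainsPower_branchK)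
    (h.branchK_le_commutator.trans hle)
  rw [← e1, ← e2, h.relIndex_psiPreimage_branchK, h.relIndex_psiPreimage_commutator,
    h.relIndex_branchK_commutator, h.relIndex_commutator_levelStab] at e3
  refine Nat.eq_of_mul_eq_mul_right (mul_pos two_pos (Nat.card_pos (α := B))) (e3.trans ?_)
  ring

end IsNondegenerate

end SpinalGroup

namespace SpinalGroup

variable {p : ℕ}

/-! ### The companion matrix -/

theorem omega_apply (f : Polynomial (ZMod p)) (b : Fin f.natDegree → ZMod p)
    {i : Fin f.natDegree} (hi : (i : ℕ) + 1 = f.natDegree) : omega f b = b i := by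
  change (omegaMatrix f).mulVec b 0 = b i
  simp only [Matrix.mulVec, dotProduct, omegaMatrix, Matrix.of_apply]
  rw [Finset.sum_eq_single i]
  · rw [if_pos hi, one_mul]
  · intro j _ hj
    rw [if_neg fun hj' => hj (Fin.ext (by omega)), zero_mul]
  · simp

theorem rho_apply_zero (f : Polynomial (ZMod p)) (b : Fin f.natDegree → ZMod p)
    {i : Fin f.natDegree} (hi : (i : ℕ) = 0) : rho f b i = -f.coeff 0 * omega f b := by
  change (rhoMatrix f).mulVec b i = _
  have hm : f.natDegree - 1 < f.natDegree := by have := i.2; omega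
  rw [omega_apply f b (i := ⟨f.natDegree - 1, hm⟩) (by simp only; omega)]
  simp only [Matrix.mulVec, dotProduct, rhoMatrix, Matrix.of_apply]
  rw [Finset.sum_eq_single ⟨f.natDegree - 1, hm⟩]
  · rw [if_pos (by simp only; omega), hi]
  · intro j _ hj
    rw [if_neg fun hj' => hj (Fin.ext (by simp only; omega)), if_neg (by omega), zero_mul]
  · simp

theorem rho_apply_succ (f : Polynomial (ZMod p)) {b : Fin f.natDegree → ZMod p}
    (hb : omega f b = 0) {i j : Fin f.natDegree} (hi : (i : ℕ) = j + 1) :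
    rho f b i = b j := by
  change (rhoMatrix f).mulVec b i = _
  simp only [Matrix.mulVec, dotProduct, rhoMatrix, Matrix.of_apply]
  rw [Finset.sum_eq_single j]
  · rw [if_neg (by have := i.2; omega), if_pos hi, one_mul]
  · intro k _ hk
    by_cases hk' : (k : ℕ) + 1 = f.natDegree
    · rw [← omega_apply f b hk', hb, mul_zero]
    · rw [if_neg hk', if_neg fun h => hk (Fin.ext (by omega)), zero_mul]
  · simp

theorem isNondegenerate_omega_rho [Fact p.Prime] (f : Polynomial (ZMod p))
    (hm : 2 ≤ f.natDegree) (hf0 : f.coeff 0 ≠ 0) : IsNondegenerate (omega f) (rho f) where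
  bijective := by
    refine Finite.injective_iff_bijective.1 ((injective_iff_map_eq_zero _).2 fun b hb => ?_)
    have h0 := rho_apply_zero f b (i := ⟨0, by omega⟩) rfl
    rw [hb, Pi.zero_apply] at h0
    have hω : omega f b = 0 := (mul_eq_zero.1 h0.symm).resolve_left (neg_ne_zero.2 hf0)
    funext j
    by_cases hj : (j : ℕ) + 1 = f.natDegree
    · rw [← omega_apply f b hj, hω]; rfl
    · rw [← rho_apply_succ f hω (i := ⟨j + 1, by have := j.2; omega⟩) rfl, hb]; rfl
  faithful := by
    have key : ∀ (n : ℕ) (b : Fin f.natDegree → ZMod p), (∀ k, omega f ((rho f)^[k] b) = 0) →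
        ∀ i : Fin f.natDegree, (i : ℕ) + n + 1 = f.natDegree → b i = 0 := by
      intro n
      induction n with
      | zero =>
        intro b hb i hi
        rw [← omega_apply f b (by omega : (i : ℕ) + 1 = _)]
        exact hb 0
      | succ n ih =>
        intro b hb i hi
        rw [← rho_apply_succ f (b := b) (hb 0) (i := ⟨i + 1, by omega⟩) rfl]
        exact ih (rho f b) (fun k => hb (k + 1)) _ (by simp only; omega)
    intro b hb
    funext i
    exact key (f.natDegree - 1 - i) b hb i (by have := i.2; omega)
  not_invariant := by
    have h1 : omega f (Pi.single ⟨f.natDegree - 2, by omega⟩ 1) = 0 := by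
      rw [omega_apply f _ (i := ⟨f.natDegree - 1, by omega⟩) (by simp only; omega)]
      refine Pi.single_eq_of_ne (fun h => ?_) _
      have := congrArg Fin.val h
      simp only at this
      omega
    refine ⟨Pi.single ⟨f.natDegree - 2, by omega⟩ 1, h1, ?_⟩
    rw [omega_apply f _ (i := ⟨f.natDegree - 1, by omega⟩) (by simp only; omega),
      rho_apply_succ f h1 (j := ⟨f.natDegree - 2, by omega⟩) (by simp only; omega),
      Pi.single_eq_same]

end SpinalGroup

theorem theorem5p1 (p m : ℕ) [Fact p.Prime] (hm : 2 ≤ m) (f : Polynomial (ZMod p))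
    (hf : f.Monic) (hdeg : f.natDegree = m) (hf0 : f.coeff 0 ≠ 0)
    (G : Subgroup (TreeAut (ZMod p))) (hG : G = SpinalGroup.Gpf f) :
    (p ≠ 2 →
      TreeAut.IsRegularBranchOver G ⁅G, G⁆ ∧
      Subgroup.relIndex ⁅G, G⁆ G = p ^ (m + 1) ∧
      TreeAut.psiPreimage G ⁅G, G⁆ ≤ ⁅G, G⁆ ∧
      (TreeAut.psiPreimage G ⁅G, G⁆).relIndex ⁅G, G⁆ = p ^ (m * (p - 1))) ∧
    (p = 2 →
      TreeAut.IsRegularBranchOver G (SpinalGroup.Kpf f) ∧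
      (SpinalGroup.Kpf f).relIndex G = 2 ^ (m + 2) ∧
      TreeAut.psiPreimage G (SpinalGroup.Kpf f) ≤ SpinalGroup.Kpf f ∧
      (TreeAut.psiPreimage G (SpinalGroup.Kpf f)).relIndex (SpinalGroup.Kpf f) = 2 ^ m) := by
  subst hG hdeg
  have h := SpinalGroup.isNondegenerate_omega_rho f hm hf0
  have hB : Nat.card (Fin f.natDegree → ZMod p) = p ^ f.natDegree := by
    rw [Nat.card_fun, Nat.card_zmod, Nat.card_fin]
  rw [SpinalGroup.Gpf, SpinalGroup.Kpf]
  refine ⟨fun hp => ?_, ?_⟩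
  · have hi := h.relIndex_commutator
    rw [hB, ← pow_succ] at hi
    have hg := h.geometricallyContainsPower_commutator hp
    exact ⟨h.isRegularBranchOver (Subgroup.commutator_le_self _)
      (SpinalGroup.normalizedBy_commutator _)
      (hi ▸ pow_ne_zero _ (Fact.out : p.Prime).ne_zero) hg, hi, TreeAut.psiPreimage_le hg,
      h.relIndex_psiPreimage_commutator_commutator hp hB⟩
  · rintro rfl
    have hi := h.relIndex_branchK
    rw [hB, show 4 = 2 ^ 2 from rfl, ← pow_add] at hi
    have hg := h.geometricallyContainsPower_branchK
    exact ⟨h.isRegularBranchOver (h.branchK_le_commutator.trans (Subgroup.commutator_le_self _))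
      SpinalGroup.normalizedBy_branchK (hi ▸ pow_ne_zero _ two_ne_zero) hg, hi,
      TreeAut.psiPreimage_le hg, h.relIndex_psiPreimage_branchK_branchK.trans hB⟩
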